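/- Let $J=(J_1,\dots,J_n)'$ be a càdlàg $n$-dimensional Lévy process with $J(0)=0$, let $r\in\mathbb R^n$ have strictly positive entries, and let $P=(p_{ij})$ be a nonnegative $n\times n$ matrix with $p_{ij}=0$ for $j\le i$ such that for every $j$ at most one $p_{ij}$ is positive; $(J,r,P)$ is then called a tree fluid network. Write $P'$ for the transpose of $P$ and put $$Y(t)=J(t)-(I-P')\,r\,t,\qquad X(t)=(I-P')^{-1}Y(t)=(I-P')^{-1}J(t)-rt .$$ For $w\in\mathbb R^n_+$, the buffer-content process with initial content $w$ is the component $W$ of the càdlàg pair $(W,L)$ that solves the Skorokhod problem of $Y$: $W(t)=w+Y(t)+(I-P')L(t)$ and $W(t)\ge 0$ for all $t\ge0$, $W(0)=w$, $L(0)=0$, $L$ is componentwise nondecreasing, and $\sum_{j=1}^n\int_0^\infty W_j(t)\,dL_j(t)=0$. Assume that (T1) if $p_{ij}>0$, then $p_{ij}>r_j/r_i$; (T2) $J_2,\dots,J_n$ are almost surely nondecreasing; (T3) $J$ is a Lévy process, as above; (T4) $J(t)$ is integrable for every $t$, and $(I-P')^{-1}\mathbb E J(1)<r$ componentwise. Let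 $\overline X_j=\sup_{t\ge0}X_j(t)$ and $\overline X=(\overline X_1,\dots,\overline X_n)'$. Then $\overline X$ is almost surely finite, and the law $\mu^*$ of $(I-P')\overline X$ is the unique stationary distribution of the buffer-content process. That is, if the initial content is random, independent of $J$, with law $\mu^*$, then $\mu^*$ is concentrated on $\mathbb R^n_+$ and $\{W(t):t\ge0\}$ is a stationary process; and conversely, every probability measure $\pi$ on $\mathbb R^n_+$ such that $W(t)$ has law $\pi$ for every $t\ge0$ whenever $W(0)$ has law $\pi$ and is independent of $J$ is equal to $\mu^*$. In particular $\mu^*$ is the only $\pi$ that makes $W$ a stationary process. -/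

import Mathlib

open MeasureTheory ProbabilityTheory Filter Topology
open scoped NNReal ENNReal Matrix

noncomputable section

namespace FluidNetwork

variable {n : ℕ} {Ω : Type*} [MeasurableSpace Ω]

/-- A path `f : [0, ∞) → ℝⁿ` is càdlàg: right-continuous with left limits. -/
structure IsCadlag (f : ℝ≥0 → Fin n → ℝ) : Prop where
  right_continuous : ∀ t, ContinuousWithinAt f (Set.Ici t) t
  left_limits : ∀ t, ∃ l, Tendsto f (𝓝[<] t) (𝓝 l)

/-- `J` is an `n`-dimensional Lévy process under `μ`: almost surely started at `0` with càdlàg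
paths, and with independent and stationary increments. -/
structure IsLevyProcess (J : ℝ≥0 → Ω → Fin n → ℝ) (μ : Measure Ω) : Prop where
  measurable : ∀ t, Measurable (J t)
  zero : ∀ᵐ ω ∂μ, J 0 ω = 0
  cadlag : ∀ᵐ ω ∂μ, IsCadlag fun t => J t ω
  indep_increments : HasIndepIncrements J μ
  stationary_increments :
    ∀ s h, IdentDistrib (fun ω => J (s + h) ω - J s ω) (fun ω => J h ω) μ μ

/-- The càdlàg pair `(W, L)` solves the Skorokhod problem of the path `Y` in the nonnegative
orthant, with reflection matrix `R` and initial condition `w`. The last field is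
`∑ⱼ ∫₀^∞ Wⱼ(t) dLⱼ(t) = 0`, where `dLⱼ` is the Lebesgue–Stieltjes measure on `[0, ∞)` of the
nondecreasing right-continuous function `Lⱼ`, which has no atom at `0` as `Lⱼ(0) = 0`. -/
structure IsSkorokhodSolution (R : Matrix (Fin n) (Fin n) ℝ) (Y : ℝ≥0 → Fin n → ℝ)
    (w : Fin n → ℝ) (W L : ℝ≥0 → Fin n → ℝ) : Prop where
  cadlag_content : IsCadlag W
  cadlag_regulator : IsCadlag L
  content_eq : ∀ t, W t = w + Y t + R *ᵥ L t
  content_nonneg : ∀ t j, 0 ≤ W t j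
  content_zero : W 0 = w
  regulator_zero : L 0 = 0
  regulator_mono : ∀ j, Monotone fun t => L t j
  complementarity :
    ∑ j, ∫⁻ t, ENNReal.ofReal (W t j) ∂(regulator_mono j).stieltjesFunction.measure = 0

/-- The fluid network with external input `J`, drain rates `r` and routing matrix `P` is a tree
fluid network: `J` is a Lévy process, drain rates are positive, a station is fed by at most one
other station, and fluid is only routed to stations with a larger index. The row sums of `P` are
not required to be at most one. -/
structure IsTreeFluidNetwork (J : ℝ≥0 → Ω → Fin n → ℝ) (r : Fin n → ℝ)
    (P : Matrix (Fin n) (Fin n) ℝ) (μ : Measure Ω) : Prop where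
  levy : IsLevyProcess J μ
  rate_pos : ∀ j, 0 < r j
  routing_nonneg : ∀ i j, 0 ≤ P i j
  routing_upper : ∀ i j, j ≤ i → P i j = 0
  one_feeder : ∀ i i' j, 0 < P i j → 0 < P i' j → i = i'

/-- The free (unreflected) process `Y(t) = J(t) - (I - P') r t`, along a path of `J`. -/
def netput (r : Fin n → ℝ) (P : Matrix (Fin n) (Fin n) ℝ) (J : ℝ≥0 → Fin n → ℝ) (t : ℝ≥0) :
    Fin n → ℝ :=
  J t - (t : ℝ) • ((1 - Pᵀ) *ᵥ r)

/-- The process `X(t) = (I - P')⁻¹ Y(t)`, along a path of `J`. -/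
def freeProcess (r : Fin n → ℝ) (P : Matrix (Fin n) (Fin n) ℝ) (J : ℝ≥0 → Fin n → ℝ) (t : ℝ≥0) :
    Fin n → ℝ :=
  (1 - Pᵀ)⁻¹ *ᵥ netput r P J t

/-- The componentwise supremum `X̄` of `X` over `[0, ∞)`, along a path of `J`. -/
def supFreeProcess (r : Fin n → ℝ) (P : Matrix (Fin n) (Fin n) ℝ) (J : ℝ≥0 → Fin n → ℝ) :
    Fin n → ℝ :=
  fun j => ⨆ t, freeProcess r P J t j

/-- The law `μ*` of `(I - P') X̄`. -/
def limitLaw (J : ℝ≥0 → Ω → Fin n → ℝ) (r : Fin n → ℝ) (P : Matrix (Fin n) (Fin n) ℝ)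
    (μ : Measure Ω) : Measure (Fin n → ℝ) :=
  μ.map fun ω => (1 - Pᵀ) *ᵥ supFreeProcess r P (fun t => J t ω)

/-- `W` is the buffer-content process of the network `(J, r, P)` whose initial content is random
with law `π` and independent of `J`. It lives on the product `Ω × ℝⁿ` with measure `μ ⊗ π`, whose
second coordinate is the initial content, and it is, together with a regulator `L`, almost surely
the solution of the Skorokhod problem of `Y` with reflection matrix `I - P'`. -/
def IsBufferContent (J : ℝ≥0 → Ω → Fin n → ℝ) (r : Fin n → ℝ) (P : Matrix (Fin n) (Fin n) ℝ)
    (μ : Measure Ω) (π : Measure (Fin n → ℝ)) (W : ℝ≥0 → Ω × (Fin n → ℝ) → Fin n → ℝ) : Prop :=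
  ∃ L : ℝ≥0 → Ω × (Fin n → ℝ) → Fin n → ℝ, ∀ᵐ x ∂(μ.prod π),
    IsSkorokhodSolution (1 - Pᵀ) (netput r P fun t => J t x.1) x.2
      (fun t => W t x) (fun t => L t x)

/-- `π` is invariant: it is a probability law on the nonnegative orthant, and if the initial
content has law `π` and is independent of `J`, then so has the content at every time. -/
structure IsInvariantDistribution (J : ℝ≥0 → Ω → Fin n → ℝ) (r : Fin n → ℝ)
    (P : Matrix (Fin n) (Fin n) ℝ) (μ : Measure Ω) (π : Measure (Fin n → ℝ)) : Prop where
  isProbabilityMeasure : IsProbabilityMeasure π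
  nonneg : ∀ᵐ w ∂π, ∀ j, 0 ≤ w j
  invariant : ∃ W, IsBufferContent J r P μ π W ∧ ∀ t, HasLaw (W t) π (μ.prod π)

/-- `π` is a stationary distribution: it is a probability law on the nonnegative orthant, and if
the initial content has law `π` and is independent of `J`, then the buffer content is a
stationary process, that is, `(W(t + h))_{t ≥ 0}` and `(W(t))_{t ≥ 0}` have the same law (on the
path space with the product σ-algebra, i.e. the same finite-dimensional distributions). -/
structure IsStationaryDistribution (J : ℝ≥0 → Ω → Fin n → ℝ) (r : Fin n → ℝ)
    (P : Matrix (Fin n) (Fin n) ℝ) (μ : Measure Ω) (π : Measure (Fin n → ℝ)) : Prop where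
  isProbabilityMeasure : IsProbabilityMeasure π
  nonneg : ∀ᵐ w ∂π, ∀ j, 0 ≤ w j
  stationary : ∃ W, IsBufferContent J r P μ π W ∧
    ∀ h, IdentDistrib (fun x t => W (t + h) x) (fun x t => W t x) (μ.prod π) (μ.prod π)

end FluidNetwork

end

/-! In the aggregated coordinates `(I - P')⁻¹ W` the network decouples. A fed station `j` with
feeder `i` sees the netput `a - p L_i`, where `p = p_ij` and `a = w_j + Y_j`. By (T1) and (T2) `a`
is nondecreasing, and `L_i` is the running supremum of the negative part of the feeder's path. In
`sup_{s ≤ t} (p L_i(s) - a(s))` each value of that path is then best used at the time it occurs, so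
the station has the same regulator as the path `a + p (z_i + X_i) = z_j + X_j`
(`isRegulator_feed_iff`). By induction along the tree, with `z = (I - P')⁻¹ w`, `(I - P')⁻¹ W(t) =
max(z + X(t), sup_{s ≤ t} (X(t) - X(s)))` componentwise, which settles existence and uniqueness for
the Skorokhod problem.

The rest is Lindley-type. Time reversal of the Lévy process `X` turns the supremum, jointly with
`X(t)`, into `sup_{s ≤ t} X(s)`. For independent `z` the aggregated content at time `t` therefore
has the law of `max(z + X(t), sup_{s ≤ t} X(s))`. Since `X → -∞` along the integers and `X̄ < ∞`,
this converges almost surely along the integers to `X̄`, so an invariant law can only be `μ*`.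
Conversely `X̄ = max(X(t) + X̄', sup_{s ≤ t} X(s))`, where `X̄'` is the supremum of the increments
after `t`, a copy of `X̄` independent of the path up to `t`. Hence `μ*` is invariant, and the flow
property gives stationarity of the whole process.

Finiteness of `X̄` comes from the strong law along the integers and a maximal inequality between
them. Suprema are handled through their upper bounds and sampled at countably many times, which
keeps them measurable. -/

noncomputable section

namespace FluidNetwork

/-! ### One-dimensional Skorokhod reflection and countable sampling of paths -/

section OneDim

/-- A real path that is right-continuous and bounded on compact intervals. -/
structure IsRegularPath (y : ℝ≥0 → ℝ) : Prop where
  right_continuous : ∀ t, ContinuousWithinAt y (Set.Ici t) t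
  bounded : ∀ t, ∃ C, ∀ s ≤ t, |y s| ≤ C

/-- `L` is the running supremum of the negative part of `y`. -/
def IsRegulator (y L : ℝ≥0 → ℝ) : Prop :=
  ∀ t c, L t ≤ c ↔ 0 ≤ c ∧ ∀ s ≤ t, -y s ≤ c

theorem IsRegulator.nonneg {y L : ℝ≥0 → ℝ} (h : IsRegulator y L) (t : ℝ≥0) : 0 ≤ L t :=
  ((h t _).1 le_rfl).1

theorem IsRegulator.neg_le {y L : ℝ≥0 → ℝ} (h : IsRegulator y L) {s t : ℝ≥0} (hst : s ≤ t) :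
    -y s ≤ L t :=
  ((h t _).1 le_rfl).2 s hst

theorem IsRegulator.monotone {y L : ℝ≥0 → ℝ} (h : IsRegulator y L) : Monotone L := fun s t hst =>
  (h s _).2 ⟨h.nonneg t, fun _ hu => h.neg_le (hu.trans hst)⟩

theorem IsRegulator.eq {y L L' : ℝ≥0 → ℝ} (h : IsRegulator y L) (h' : IsRegulator y L')
    (t : ℝ≥0) : L t = L' t :=
  eq_of_forall_ge_iff fun c => (h t c).trans (h' t c).symm

theorem IsRegulator.zero {y L : ℝ≥0 → ℝ} (h : IsRegulator y L) (hy : 0 ≤ y 0) : L 0 = 0 := by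
  refine le_antisymm ((h 0 0).2 ⟨le_rfl, fun s hs => ?_⟩) (h.nonneg 0)
  have : s = 0 := le_antisymm hs (zero_le)
  subst this; linarith

theorem exists_Ico_of_continuousWithinAt_Ici {y : ℝ≥0 → ℝ} {s : ℝ≥0} {p : ℝ → Prop}
    (hy : ContinuousWithinAt y (Set.Ici s) s) (hp : ∀ᶠ v in 𝓝 (y s), p v) :
    ∃ u, s < u ∧ ∀ v ∈ Set.Ico s u, p (y v) := by
  have h1 : ∀ᶠ v in 𝓝[≥] s, p (y v) := hy hp
  obtain ⟨u, hu, h2⟩ := (mem_nhdsGE_iff_exists_Ico_subset' (show s < s + 1 by simp)).1 h1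
  exact ⟨u, hu, fun v hv => h2 hv⟩

theorem IsRegulator.eq_of_lt {y L : ℝ≥0 → ℝ} (h : IsRegulator y L) {s u v : ℝ≥0}
    (hu : ∀ a ∈ Set.Ico s u, -y a ≤ L s) (hv : v ∈ Set.Ico s u) : L v = L s := by
  refine le_antisymm ((h v _).2 ⟨h.nonneg s, fun a ha => ?_⟩) (h.monotone hv.1)
  rcases lt_or_ge a s with has | has
  · exact h.neg_le has.le
  · exact hu a ⟨has, ha.trans_lt hv.2⟩

theorem IsRegulator.right_continuous {y L : ℝ≥0 → ℝ} (h : IsRegulator y L)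
    (hy : IsRegularPath y) (t : ℝ≥0) : ContinuousWithinAt L (Set.Ici t) t := by
  refine Metric.continuousWithinAt_iff'.2 fun ε hε => ?_
  obtain ⟨u, hu, h2⟩ := exists_Ico_of_continuousWithinAt_Ici (hy.right_continuous t)
    (p := fun v => y t - ε / 2 < v) (lt_mem_nhds (by linarith))
  filter_upwards [Ico_mem_nhdsGE hu] with v hv
  have h3 : L v ≤ L t + ε / 2 := by
    refine (h v _).2 ⟨by have := h.nonneg t; linarith, fun a ha => ?_⟩
    rcases le_or_gt a t with hat | hat
    · have := h.neg_le hat; linarith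
    · have := h2 a ⟨hat.le, ha.trans_lt hv.2⟩
      have := h.neg_le (le_refl t); linarith
  have h4 := h.monotone hv.1
  rw [Real.dist_eq, abs_lt]; constructor <;> linarith

/-- `Monotone.stieltjesFunction` is built from right limits, so right-continuity is exactly what
makes it agree with `L`. -/
theorem stieltjesFunction_eq_self {L : ℝ≥0 → ℝ} (hL : Monotone L)
    (hc : ∀ t, ContinuousWithinAt L (Set.Ici t) t) (t : ℝ≥0) : hL.stieltjesFunction t = L t := by
  rw [hL.stieltjesFunction_eq, ← hL.continuousWithinAt_Ioi_iff_rightLim_eq,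
    continuousWithinAt_Ioi_iff_Ici]
  exact hc t

/-- A set that contains a right neighbourhood of measure zero of each of its points is null. -/
theorem measure_eq_zero_of_Ico {m : Measure ℝ≥0} {A : Set ℝ≥0}
    (h : ∀ s ∈ A, ∃ u, s < u ∧ m (Set.Ico s u) = 0) : m A = 0 := by
  choose! u hu hm using h
  -- Lindelöf: countably many of the open intervals have the same union.
  have hU : m (⋃ s ∈ A, Set.Ioo s (u s)) = 0 := by
    obtain ⟨T, hTA, hTc, hT⟩ :=
      TopologicalSpace.isOpen_biUnion_countable A (fun s => Set.Ioo s (u s)) fun _ _ => isOpen_Ioo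
    rw [← hT, measure_biUnion_null_iff hTc]
    exact fun s hs => measure_mono_null Set.Ioo_subset_Ico_self (hm s (hTA hs))
  -- A leftover point lies in none of the open intervals, so those starting at leftover points are
  -- pairwise disjoint, hence countable in number.
  have hC : (A \ ⋃ s ∈ A, Set.Ioo s (u s)).Countable := by
    refine Set.PairwiseDisjoint.countable_of_Ioo (y := u) ?_ fun s hs => hu s hs.1
    intro a ha b hb hab
    have key : ∀ {a b}, a ∈ A → b ∈ A \ (⋃ s ∈ A, Set.Ioo s (u s)) → a < b →
        Disjoint (Set.Ioo a (u a)) (Set.Ioo b (u b)) := by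
      intro a b ha hb hlt
      have h1 : u a ≤ b := by
        by_contra! h1
        exact hb.2 (Set.mem_biUnion ha ⟨hlt, h1⟩)
      exact Set.disjoint_left.2 fun x hx hx' => absurd (hx.2.trans_le h1) (not_lt.2 hx'.1.le)
    rcases lt_or_gt_of_ne hab with h | h
    · exact key ha.1 hb h
    · exact (key hb.1 ha h).symm
  have hC0 : m (A \ ⋃ s ∈ A, Set.Ioo s (u s)) = 0 := by
    rw [← Set.biUnion_of_singleton (A \ _), measure_biUnion_null_iff hC]
    exact fun s hs => measure_mono_null
      (Set.singleton_subset_iff.2 (Set.mem_Ico.2 ⟨le_rfl, hu s hs.1⟩)) (hm s hs.1)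
  refine measure_mono_null ?_ (measure_union_null hU hC0)
  intro s hs
  by_cases h : s ∈ ⋃ s ∈ A, Set.Ioo s (u s)
  · exact Or.inl h
  · exact Or.inr ⟨hs, h⟩

theorem leftLim_le_of_forall_lt {L : ℝ≥0 → ℝ} (hL : Monotone L) {s : ℝ≥0} {c : ℝ}
    (h0 : s = 0 → L 0 ≤ c) (h : ∀ v < s, L v ≤ c) : Function.leftLim L s ≤ c := by
  rcases eq_or_ne s 0 with rfl | hs
  -- There is nothing to the left of `0`, and `leftLim` takes the default value `L 0` there.
  · rw [leftLim_eq_of_eq_bot]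
    · exact h0 rfl
    · exact nhdsLT_eq_bot_iff.2 (Or.inl isBot_bot)
  · have : (𝓝[<] s).NeBot := nhdsLT_neBot_of_exists_lt ⟨0, pos_iff_ne_zero.2 hs⟩
    refine le_of_tendsto (hL.tendsto_leftLim s) ?_
    filter_upwards [self_mem_nhdsWithin] with v hv using h v hv

/-- The regulator only increases when the reflected path vanishes. -/
theorem IsRegulator.complementarity {y L : ℝ≥0 → ℝ} (h : IsRegulator y L)
    (hy : IsRegularPath y) (hL : Monotone L) :
    ∫⁻ t, ENNReal.ofReal (y t + L t) ∂hL.stieltjesFunction.measure = 0 := by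
  have hnull : hL.stieltjesFunction.measure {t | 0 < y t + L t} = 0 := by
    refine measure_eq_zero_of_Ico fun s hs => ?_
    have hs' : -L s < y s := by have : 0 < y s + L s := hs; linarith
    obtain ⟨u, hu, h2⟩ := exists_Ico_of_continuousWithinAt_Ici (hy.right_continuous s)
      (p := fun v => -L s < v) (lt_mem_nhds hs')
    refine ⟨u, hu, ?_⟩
    rw [StieltjesFunction.measure_Ico, ENNReal.ofReal_eq_zero, sub_nonpos]
    have hSL : (hL.stieltjesFunction : ℝ≥0 → ℝ) = L :=
      funext (stieltjesFunction_eq_self hL (h.right_continuous hy))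
    rw [hSL]
    -- On `[s, u)` the path `-y` stays below `L s`, so `L` does not grow there.
    have h3 : Function.leftLim L u ≤ L s := by
      refine leftLim_le_of_forall_lt hL (fun h0 => absurd hu (by simp [h0])) fun v hv => ?_
      rcases lt_or_ge v s with h4 | h4
      · exact hL h4.le
      · exact (h.eq_of_lt (fun a ha => by have := h2 a ha; linarith) ⟨h4, hv⟩).le
    refine h3.trans ?_
    rcases eq_or_ne s 0 with rfl | hs0
    · rw [leftLim_eq_of_eq_bot]
      exact nhdsLT_eq_bot_iff.2 (Or.inl isBot_bot)
    · have hne : (𝓝[<] s).NeBot := nhdsLT_neBot_of_exists_lt ⟨0, pos_iff_ne_zero.2 hs0⟩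
      have hle : ∀ v < s, L v ≤ Function.leftLim L s := fun v hv => hL.le_leftLim hv
      by_contra! hlt
      -- If `L` jumped at `s`, some level `c < L s` would dominate both the left limit and `-y s`,
      -- hence `-y` on all of `[0, s]`.
      obtain ⟨c, hc1, hc2⟩ := exists_between (max_lt hlt (show -y s < L s by linarith))
      refine absurd ((h s c).2 ⟨?_, fun a ha => ?_⟩) (not_le.2 hc2)
      · have := h.nonneg 0
        have := hle 0 (pos_iff_ne_zero.2 hs0)
        have := le_max_left (Function.leftLim L s) (-y s)
        linarith
      · rcases ha.eq_or_lt with rfl | ha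
        · exact (le_max_right _ _).trans hc1.le
        · exact ((h.neg_le le_rfl).trans (hle a ha)).trans ((le_max_left _ _).trans hc1.le)
  rw [lintegral_eq_zero_of_ae_eq_zero]
  rw [Filter.EventuallyEq, ae_iff]
  refine measure_mono_null (fun t ht => ?_) hnull
  simpa using ht

/-- Uniqueness in the one-dimensional Skorokhod problem. -/
theorem isRegulator_of_complementarity {y L : ℝ≥0 → ℝ} (hy : IsRegularPath y)
    (hL : Monotone L) (hc : ∀ t, ContinuousWithinAt L (Set.Ici t) t) (h0 : L 0 = 0)
    (hW : ∀ t, 0 ≤ y t + L t)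
    (hcomp : ∫⁻ t, ENNReal.ofReal (y t + L t) ∂hL.stieltjesFunction.measure = 0) :
    IsRegulator y L := by
  have hSL : (hL.stieltjesFunction : ℝ≥0 → ℝ) = L := funext (stieltjesFunction_eq_self hL hc)
  have hflat : ∀ s, 0 < y s + L s → ∃ u, s < u ∧ Function.leftLim L u ≤ Function.leftLim L s := by
    intro s hs
    obtain ⟨u, hu, h2⟩ := exists_Ico_of_continuousWithinAt_Ici
      ((hy.right_continuous s).add (hc s))
      (p := fun v => (y s + L s) / 2 < v) (lt_mem_nhds (by simp only [Pi.add_apply]; linarith))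
    refine ⟨u, hu, ?_⟩
    -- Markov: the reflected path exceeds half its value at `s` throughout `[s, u)`, so
    -- complementarity makes that interval null.
    have h3 : ENNReal.ofReal ((y s + L s) / 2) * hL.stieltjesFunction.measure (Set.Ico s u)
        ≤ 0 := by
      rw [← hcomp, ← setLIntegral_const]
      refine (setLIntegral_mono' measurableSet_Ico fun v hv => ?_).trans (setLIntegral_le_lintegral _ _)
      exact ENNReal.ofReal_le_ofReal (h2 v hv).le
    have h4 : hL.stieltjesFunction.measure (Set.Ico s u) = 0 := by
      rcases mul_eq_zero.1 (le_antisymm h3 zero_le) with h5 | h5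
      · exact absurd (ENNReal.ofReal_eq_zero.1 h5) (by linarith)
      · exact h5
    rwa [StieltjesFunction.measure_Ico, ENNReal.ofReal_eq_zero, sub_nonpos, hSL] at h4
  intro t c
  constructor
  · intro h
    refine ⟨by have := hL (zero_le : (0 : ℝ≥0) ≤ t); linarith, fun s hs => ?_⟩
    have := hW s
    have := hL hs
    linarith
  · rintro ⟨hc0, hcs⟩
    by_contra! hlt
    obtain ⟨d, hd1, hd2⟩ := exists_between hlt
    set B : Set ℝ≥0 := {s | L s ≤ d} with hB
    have hB0 : (0 : ℝ≥0) ∈ B := by simp only [hB, Set.mem_ofPred_eq]; linarith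
    have hBt : ∀ s ∈ B, s ≤ t := fun s hs => by
      by_contra! h
      have h1 : L s ≤ d := hs
      have := hL h.le
      linarith
    have hBbdd : BddAbove B := ⟨t, hBt⟩
    -- At the time `τ` when `L` passes the level `d > c`, one has `L τ ≥ d > c ≥ -y τ`. The
    -- reflected path is thus positive at `τ`, which forbids growth across `τ`.
    set τ := sSup B with hτ
    have hτt : τ ≤ t := csSup_le ⟨0, hB0⟩ hBt
    have hbelow : ∀ v < τ, L v ≤ d := fun v hv => by
      obtain ⟨s, hs, hvs⟩ := exists_lt_of_lt_csSup ⟨0, hB0⟩ hv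
      exact (hL hvs.le).trans hs
    have habove : ∀ v, τ < v → d < L v := fun v hv => by
      by_contra! h
      exact absurd (le_csSup hBbdd h) (not_le.2 hv)
    have hτd : d ≤ L τ := by
      have h1 : Tendsto L (𝓝[>] τ) (𝓝 (L τ)) := (hc τ).mono Set.Ioi_subset_Ici_self
      refine ge_of_tendsto h1 ?_
      filter_upwards [self_mem_nhdsWithin] with v hv using (habove v hv).le
    have hpos : 0 < y τ + L τ := by
      have := hcs τ hτt
      linarith
    obtain ⟨u, hu, hle⟩ := hflat τ hpos
    obtain ⟨v, hv1, hv2⟩ := exists_between hu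
    have h1 : L v ≤ Function.leftLim L u := hL.le_leftLim hv2
    have h2 : Function.leftLim L τ ≤ d :=
      leftLim_le_of_forall_lt hL (fun _ => by linarith) hbelow
    have := habove v hv1
    linarith

/-- Replacing the netput of a station by its aggregated netput does not change the regulator, if
the difference of the two is a nondecreasing process. -/
theorem isRegulator_feed_iff {y₁ L₁ a L₂ : ℝ≥0 → ℝ} {p : ℝ} (h₁ : IsRegulator y₁ L₁) (hp : 0 < p)
    (ha : Monotone a) (ha0 : 0 ≤ a 0) :
    IsRegulator (fun t => a t - p * L₁ t) L₂ ↔ IsRegulator (fun t => a t + p * y₁ t) L₂ := by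
  refine forall₂_congr fun t c => iff_congr Iff.rfl (and_congr_right fun hc => ?_)
  constructor
  · intro h s hs
    have h1 := h s hs
    have h2 := mul_le_mul_of_nonneg_left (h₁.neg_le (le_refl s)) hp.le
    simp only at h1 ⊢
    linarith
  · intro h s hs
    -- Bounding `L₁ s` means bounding `-y₁ u` for all `u ≤ s`; the hypothesis at `u` suffices
    -- because `a u ≤ a s`.
    have h2 : L₁ s ≤ (c + a s) / p := by
      refine (h₁ s _).2 ⟨div_nonneg (add_nonneg hc (ha0.trans (ha zero_le))) hp.le, fun u hu => ?_⟩
      rw [le_div_iff₀ hp]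
      have h3 := h u (hu.trans hs)
      have h4 := ha hu
      simp only at h3
      linarith
    rw [le_div_iff₀ hp] at h2
    simp only
    linarith

/-- An upper bound along a dense set of times in `[0, t]` that contains `t` is an upper bound on
`[0, t]`. -/
theorem forall_le_iff_of_dense {f : ℝ≥0 → ℝ} (hf : ∀ t, ContinuousWithinAt f (Set.Ici t) t)
    {S : ℚ≥0 → ℝ≥0} {t : ℝ≥0} (hSt : ∀ q, S q ≤ t) (ht : ∃ q, S q = t)
    (hS : ∀ u v, u < v → v ≤ t → ∃ q, u < S q ∧ S q < v) (c : ℝ) :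
    (∀ q, f (S q) ≤ c) ↔ ∀ s ≤ t, f s ≤ c := by
  refine ⟨fun h s hs => ?_, fun h q => h _ (hSt q)⟩
  by_contra! hlt
  rcases hs.eq_or_lt with rfl | hst
  · obtain ⟨q, rfl⟩ := ht
    exact absurd (h q) (not_le.2 hlt)
  · obtain ⟨u, hu, h2⟩ := exists_Ico_of_continuousWithinAt_Ici (hf s)
      (p := fun v => c < v) (lt_mem_nhds hlt)
    obtain ⟨q, hq1, hq2⟩ := hS s (min u t) (lt_min hu hst) (min_le_right _ _)
    exact absurd (h q) (not_le.2 (h2 _ ⟨hq1.le, hq2.trans_le (min_le_left _ _)⟩))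

theorem exists_nnrat_btwn {u v : ℝ≥0} (h : u < v) : ∃ q : ℚ≥0, u < (q : ℝ≥0) ∧ (q : ℝ≥0) < v := by
  obtain ⟨q, h1, h2⟩ := exists_rat_btwn (NNReal.coe_lt_coe.2 h)
  have hq : 0 ≤ q := by
    have : (0 : ℝ) < q := lt_of_le_of_lt u.2 h1
    exact_mod_cast this.le
  lift q to ℚ≥0 using hq
  have hcast : ((q : ℝ≥0) : ℝ) = ((q : ℚ) : ℝ) := by
    rw [show ((q : ℝ≥0) : ℝ) = (q : ℝ) from rfl]
    norm_cast
  exact ⟨q, by rwa [← NNReal.coe_lt_coe, hcast], by rwa [← NNReal.coe_lt_coe, hcast]⟩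

theorem forall_min_le_iff {f : ℝ≥0 → ℝ} (hf : ∀ t, ContinuousWithinAt f (Set.Ici t) t)
    (t : ℝ≥0) (c : ℝ) : (∀ q : ℚ≥0, f (min (q : ℝ≥0) t) ≤ c) ↔ ∀ s ≤ t, f s ≤ c := by
  refine forall_le_iff_of_dense hf (fun _ => min_le_right _ _) ?_ ?_ c
  · obtain ⟨q, hq, -⟩ := exists_nnrat_btwn (show t < t + 1 by simp)
    exact ⟨q, min_eq_right hq.le⟩
  · intro u v huv hvt
    obtain ⟨q, h1, h2⟩ := exists_nnrat_btwn huv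
    exact ⟨q, by rwa [min_eq_left (h2.le.trans hvt)], by rwa [min_eq_left (h2.le.trans hvt)]⟩

/-- These are the sampling times that appear after time reversal on `[0, t]`; `q = 0` supplies the
endpoint `t`, where right-continuity gives no information within `[0, t]`. -/
theorem forall_sub_le_iff {f : ℝ≥0 → ℝ} (hf : ∀ t, ContinuousWithinAt f (Set.Ici t) t)
    (t : ℝ≥0) (c : ℝ) : (∀ q : ℚ≥0, f (t - min (q : ℝ≥0) t) ≤ c) ↔ ∀ s ≤ t, f s ≤ c := by
  refine forall_le_iff_of_dense hf (fun _ => tsub_le_self) ⟨0, by simp⟩ ?_ c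
  intro u v huv hvt
  obtain ⟨q, h1, h2⟩ := exists_nnrat_btwn
    (show t - v < t - u from tsub_lt_tsub_left_of_le hvt huv)
  have hqt : (q : ℝ≥0) ≤ t := h2.le.trans tsub_le_self
  refine ⟨q, ?_, ?_⟩ <;> rw [min_eq_left hqt]
  · exact lt_tsub_comm.1 h2
  · exact (tsub_lt_iff_left hqt).2 ((tsub_lt_iff_right hvt).1 h1)

theorem forall_nnrat_le_iff {f : ℝ≥0 → ℝ} (hf : ∀ t, ContinuousWithinAt f (Set.Ici t) t)
    (c : ℝ) : (∀ q : ℚ≥0, f q ≤ c) ↔ ∀ s, f s ≤ c := by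
  refine ⟨fun h s => ?_, fun h q => h _⟩
  by_contra! hlt
  obtain ⟨u, hu, h2⟩ := exists_Ico_of_continuousWithinAt_Ici (hf s)
      (p := fun v => c < v) (lt_mem_nhds hlt)
  obtain ⟨q, hq1, hq2⟩ := exists_nnrat_btwn hu
  exact absurd (h q) (not_le.2 (h2 _ ⟨hq1.le, hq2⟩))

end OneDim

/-! ### Càdlàg paths and the explicit aggregated content -/

section Deterministic

variable {n : ℕ}

section Cadlag

theorem IsCadlag.comp_continuous {m : ℕ} {f : ℝ≥0 → Fin n → ℝ} (hf : IsCadlag f)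
    {g : (Fin n → ℝ) → Fin m → ℝ} (hg : Continuous g) : IsCadlag fun t => g (f t) where
  right_continuous t := hg.continuousAt.comp_continuousWithinAt (hf.right_continuous t)
  left_limits t := by
    obtain ⟨l, hl⟩ := hf.left_limits t
    exact ⟨g l, (hg.tendsto l).comp hl⟩

theorem IsCadlag.add {f g : ℝ≥0 → Fin n → ℝ} (hf : IsCadlag f) (hg : IsCadlag g) :
    IsCadlag fun t => f t + g t where
  right_continuous t := (hf.right_continuous t).add (hg.right_continuous t)
  left_limits t := by
    obtain ⟨l, hl⟩ := hf.left_limits t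
    obtain ⟨l', hl'⟩ := hg.left_limits t
    exact ⟨l + l', hl.add hl'⟩

theorem isCadlag_of_continuous {f : ℝ≥0 → Fin n → ℝ} (hf : Continuous f) : IsCadlag f where
  right_continuous _ := hf.continuousWithinAt
  left_limits t := ⟨f t, hf.continuousWithinAt⟩

theorem isCadlag_of_monotone {f : ℝ≥0 → Fin n → ℝ} (hm : ∀ j, Monotone fun t => f t j)
    (hc : ∀ j t, ContinuousWithinAt (fun t => f t j) (Set.Ici t) t) : IsCadlag f where
  right_continuous t := continuousWithinAt_pi.2 fun j => hc j t
  left_limits t := ⟨fun j => Function.leftLim (fun t => f t j) t,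
    tendsto_pi_nhds.2 fun j => (hm j).tendsto_leftLim t⟩

theorem IsCadlag.isRegularPath {f : ℝ≥0 → Fin n → ℝ} (hf : IsCadlag f) (j : Fin n) :
    IsRegularPath fun t => f t j where
  right_continuous t := continuousWithinAt_pi.1 (hf.right_continuous t) j
  bounded t := by
    -- A left limit and right-continuity bound the path near each point; compactness makes the bound
    -- uniform.
    have key : ∃ C, ∀ s ∈ Set.Icc 0 t, |f s j| ≤ C := by
      refine (isCompact_Icc (a := (0 : ℝ≥0)) (b := t)).induction_on
        (p := fun S => ∃ C, ∀ s ∈ S, |f s j| ≤ C) ⟨0, by simp⟩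
        (fun S T hST ⟨C, hC⟩ => ⟨C, fun s hs => hC s (hST hs)⟩) ?_ ?_
      · rintro S T ⟨C, hC⟩ ⟨D, hD⟩
        exact ⟨max C D, fun s hs => hs.elim (fun h => (hC s h).trans (le_max_left _ _))
          fun h => (hD s h).trans (le_max_right _ _)⟩
      · intro s _
        obtain ⟨l, hl⟩ := hf.left_limits s
        have h1 : ∀ᶠ v in 𝓝[<] s, |f v j| ≤ |l j| + 1 :=
          ((tendsto_pi_nhds.1 hl j).abs).eventually_le_const (by linarith)
        have h2 : ∀ᶠ v in 𝓝[≥] s, |f v j| ≤ |f s j| + 1 :=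
          (continuousWithinAt_pi.1 (hf.right_continuous s) j).abs.eventually_le_const
            (by simp)
        have h3 : ∀ᶠ v in 𝓝 s, |f v j| ≤ max (|l j| + 1) (|f s j| + 1) := by
          rw [← nhdsLT_sup_nhdsGE, eventually_sup]
          exact ⟨h1.mono fun v hv => hv.trans (le_max_left _ _),
            h2.mono fun v hv => hv.trans (le_max_right _ _)⟩
        exact ⟨_, mem_nhdsWithin_of_mem_nhds h3, _, fun v hv => hv⟩
    obtain ⟨C, hC⟩ := key
    exact ⟨C, fun s hs => hC s ⟨zero_le, hs⟩⟩

theorem IsCadlag.shift {f : ℝ≥0 → Fin n → ℝ} (hf : IsCadlag f) (h : ℝ≥0) :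
    IsCadlag fun u => f (h + u) - f h where
  right_continuous t := by
    refine ContinuousWithinAt.sub ?_ continuousWithinAt_const
    exact (hf.right_continuous (h + t)).comp (by fun_prop)
      fun u hu => add_le_add_right (Set.mem_Ici.1 hu) h
  left_limits t := by
    obtain ⟨l, hl⟩ := hf.left_limits (h + t)
    refine ⟨l - f h, (hl.comp ?_).sub tendsto_const_nhds⟩
    refine tendsto_nhdsWithin_iff.2 ⟨?_, ?_⟩
    · exact (by fun_prop : ContinuousAt (fun u => h + u) t).tendsto.mono_left nhdsWithin_le_nhds
    · filter_upwards [self_mem_nhdsWithin] with u hu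
      exact add_lt_add_right (Set.mem_Iio.1 hu) h

end Cadlag

section Content

/-- The aggregated content `(I - P')⁻¹ W(t)` of a tree fluid network with aggregated initial
content `z` and aggregated netput `x`. The supremum over `[0, t]` is taken along a countable dense
set of times. -/
def aggregateContent (z : Fin n → ℝ) (x : ℝ≥0 → Fin n → ℝ) (t : ℝ≥0) : Fin n → ℝ :=
  fun j => max (z j + x t j) (⨆ q : ℚ≥0, (x t j - x (min (q : ℝ≥0) t) j))

variable {x : ℝ≥0 → Fin n → ℝ}

/-- Local boundedness matters: the real `⨆` of an unbounded family is `0` by default. -/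
theorem iSup_reflected_le_iff {y : ℝ≥0 → ℝ} (hy : IsRegularPath y) (t : ℝ≥0) (c : ℝ) :
    (⨆ q : ℚ≥0, (y t - y (min (q : ℝ≥0) t))) ≤ c ↔ ∀ s ≤ t, y t - y s ≤ c := by
  obtain ⟨C, hC⟩ := hy.bounded t
  rw [ciSup_le_iff]
  · exact forall_min_le_iff (f := fun s => y t - y s)
      (fun s => continuousWithinAt_const.sub (hy.right_continuous s)) t c
  · refine ⟨C + C, ?_⟩
    rintro _ ⟨q, rfl⟩
    have h1 := abs_le.1 (hC t le_rfl)
    have h2 := abs_le.1 (hC _ (min_le_right (q : ℝ≥0) t))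
    simp only
    linarith

theorem aggregateContent_le_iff (hx : IsCadlag x) (z : Fin n → ℝ) (t : ℝ≥0) (j : Fin n) (c : ℝ) :
    aggregateContent z x t j ≤ c ↔ z j + x t j ≤ c ∧ ∀ s ≤ t, x t j - x s j ≤ c := by
  rw [aggregateContent, max_le_iff, iSup_reflected_le_iff (hx.isRegularPath j)]

/-- Subtracting `z j + x t j` from both terms of the maximum leaves `max(0, sup_{s ≤ t} -(z j + x s
j))`. -/
theorem isRegulator_aggregateContent (hx : IsCadlag x) (z : Fin n → ℝ) (j : Fin n) :
    IsRegulator (fun t => z j + x t j) (fun t => aggregateContent z x t j - z j - x t j) := by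
  intro t c
  rw [show aggregateContent z x t j - z j - x t j ≤ c ↔
    aggregateContent z x t j ≤ z j + x t j + c by constructor <;> intro h <;> linarith,
    aggregateContent_le_iff hx]
  refine and_congr (by constructor <;> intro h <;> linarith) (forall₂_congr fun s _ => ?_)
  constructor <;> intro h <;> linarith

/-- The flow property of the aggregated content. -/
theorem aggregateContent_add (hx : IsCadlag x) (z : Fin n → ℝ) (h t : ℝ≥0) :
    aggregateContent (aggregateContent z x h) (fun u => x (h + u) - x h) t =
      aggregateContent z x (h + t) := by
  funext j
  refine eq_of_forall_ge_iff fun c => ?_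
  rw [aggregateContent_le_iff (hx.shift h), aggregateContent_le_iff hx]
  have h1 : aggregateContent z x h j + (x (h + t) - x h) j ≤ c ↔
      aggregateContent z x h j ≤ c - (x (h + t) j - x h j) := by
    simp only [Pi.sub_apply]
    constructor <;> intro h <;> linarith
  rw [h1, aggregateContent_le_iff hx]
  simp only [Pi.sub_apply]
  constructor
  · rintro ⟨⟨h2, h3⟩, h4⟩
    refine ⟨by linarith, fun s hs => ?_⟩
    rcases le_total s h with hsh | hsh
    · have := h3 s hsh
      linarith
    · obtain ⟨v, rfl⟩ := exists_add_of_le hsh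
      have := h4 v (le_of_add_le_add_left hs)
      linarith
  · rintro ⟨h2, h3⟩
    refine ⟨⟨by linarith, fun s hs => ?_⟩, fun s hs => ?_⟩
    · have := h3 s (hs.trans (le_add_of_nonneg_right zero_le))
      linarith
    · have := h3 (h + s) (add_le_add_right hs h)
      linarith

end Content

/-! ### The Skorokhod problem of a tree network -/

section Tree

variable {r : Fin n → ℝ} {P : Matrix (Fin n) (Fin n) ℝ} {J : ℝ≥0 → Fin n → ℝ}

/-- Unit lower triangularity makes `⁻¹` a genuine inverse without any row-sum condition on `P`. -/
theorem det_one_sub_transpose (hup : ∀ i j, j ≤ i → P i j = 0) : (1 - Pᵀ).det = 1 := by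
  rw [Matrix.det_of_isLowerTriangular]
  · refine Finset.prod_eq_one fun i _ => ?_
    simp [hup i i le_rfl]
  · intro i j hij
    have hij' : i < j := hij
    simp [hup j i hij'.le, Matrix.one_apply_ne hij'.ne]

theorem mulVec_inv_mulVec (hup : ∀ i j, j ≤ i → P i j = 0) (v : Fin n → ℝ) :
    (1 - Pᵀ) *ᵥ ((1 - Pᵀ)⁻¹ *ᵥ v) = v := by
  rw [Matrix.mulVec_mulVec, Matrix.mul_nonsing_inv _ (by simp [det_one_sub_transpose hup]),
    Matrix.one_mulVec]

theorem inv_mulVec_mulVec (hup : ∀ i j, j ≤ i → P i j = 0) (v : Fin n → ℝ) :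
    (1 - Pᵀ)⁻¹ *ᵥ ((1 - Pᵀ) *ᵥ v) = v := by
  rw [Matrix.mulVec_mulVec, Matrix.nonsing_inv_mul _ (by simp [det_one_sub_transpose hup]),
    Matrix.one_mulVec]

/-- Routing data of a tree fluid network in which downstream stations are slower. -/
structure IsTreeRouting (r : Fin n → ℝ) (P : Matrix (Fin n) (Fin n) ℝ) : Prop where
  rate_pos : ∀ j, 0 < r j
  routing_nonneg : ∀ i j, 0 ≤ P i j
  routing_upper : ∀ i j, j ≤ i → P i j = 0
  one_feeder : ∀ i i' j, 0 < P i j → 0 < P i' j → i = i'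
  feed_rate : ∀ i j, 0 < P i j → r j / r i < P i j

theorem mulVec_apply_eq_sub_sum (v : Fin n → ℝ) (j : Fin n) :
    ((1 - Pᵀ) *ᵥ v) j = v j - ∑ i, P i j * v i := by
  rw [Matrix.sub_mulVec, Matrix.one_mulVec, Pi.sub_apply]
  rfl

/-- A station is either a root of the tree or has exactly one feeder. -/
theorem IsTreeRouting.root_or_feeder (h : IsTreeRouting r P) (j : Fin n) :
    (∀ v : Fin n → ℝ, ((1 - Pᵀ) *ᵥ v) j = v j) ∨
      ∃ i < j, 0 < P i j ∧ ∀ v : Fin n → ℝ, ((1 - Pᵀ) *ᵥ v) j = v j - P i j * v i := by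
  by_cases hj : ∃ i, 0 < P i j
  · obtain ⟨i, hi⟩ := hj
    refine Or.inr ⟨i, ?_, hi, fun v => ?_⟩
    · by_contra! hij
      exact hi.ne' (h.routing_upper i j hij)
    · rw [mulVec_apply_eq_sub_sum, Finset.sum_eq_single i]
      · intro i' _ hne
        rcases (h.routing_nonneg i' j).eq_or_lt with h0 | h0
        · rw [← h0, zero_mul]
        · exact absurd (h.one_feeder i' i j h0 hi) hne
      · simp
  · push Not at hj
    refine Or.inl fun v => ?_
    rw [mulVec_apply_eq_sub_sum, Finset.sum_eq_zero, sub_zero]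
    intro i _
    rw [le_antisymm (hj i) (h.routing_nonneg i j), zero_mul]

/-- A sample path of the input of a tree fluid network. -/
structure IsInputPath (J : ℝ≥0 → Fin n → ℝ) : Prop where
  cadlag : IsCadlag J
  zero : J 0 = 0
  mono : ∀ j : Fin n, 0 < (j : ℕ) → Monotone fun t => J t j

theorem isCadlag_netput (hJ : IsCadlag J) : IsCadlag (netput r P J) := by
  have h1 : IsCadlag fun t : ℝ≥0 => -((t : ℝ) • ((1 - Pᵀ) *ᵥ r)) :=
    isCadlag_of_continuous (by fun_prop)
  have h2 : netput r P J = fun t => J t + -((t : ℝ) • ((1 - Pᵀ) *ᵥ r)) :=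
    funext fun t => sub_eq_add_neg _ _
  rw [h2]
  exact hJ.add h1

theorem isCadlag_mulVec {x : ℝ≥0 → Fin n → ℝ} (hx : IsCadlag x) (M : Matrix (Fin n) (Fin n) ℝ) :
    IsCadlag fun t => M *ᵥ x t :=
  hx.comp_continuous (g := fun v => M *ᵥ v) (by fun_prop)

theorem isCadlag_freeProcess (hJ : IsCadlag J) : IsCadlag (freeProcess r P J) :=
  isCadlag_mulVec (isCadlag_netput hJ) _

theorem IsTreeRouting.mulVec_freeProcess_eq (h : IsTreeRouting r P) (t : ℝ≥0) :
    (1 - Pᵀ) *ᵥ freeProcess r P J t = netput r P J t :=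
  mulVec_inv_mulVec h.routing_upper _

theorem netput_zero (hJ : J 0 = 0) : netput r P J 0 = 0 := by simp [netput, hJ]

theorem freeProcess_zero (hJ : J 0 = 0) : freeProcess r P J 0 = 0 := by
  simp [freeProcess, netput_zero hJ]

/-- At a fed station the netput is `J_j(t) + (p_ij r_i - r_j) t`: (T1) makes the drift positive, and
(T2) applies since `i < j` rules out the first station. -/
theorem IsTreeRouting.monotone_netput (h : IsTreeRouting r P) (hJ : IsInputPath J) {i j : Fin n}
    (hij : 0 < P i j) (hlt : i < j) (hR : ∀ v : Fin n → ℝ, ((1 - Pᵀ) *ᵥ v) j = v j - P i j * v i) :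
    Monotone fun t => netput r P J t j := by
  intro s t hst
  simp only [netput, Pi.sub_apply, Pi.smul_apply, hR, smul_eq_mul]
  have h1 := hJ.mono j (lt_of_le_of_lt (Nat.zero_le _) hlt) hst
  have h2 := (div_lt_iff₀ (h.rate_pos i)).1 (h.feed_rate i j hij)
  have h3 : (s : ℝ) ≤ t := hst
  simp only at h1
  nlinarith

/-- The regulator equation of station `j` in terms of the aggregated netput, given the regulators
upstream. -/
theorem IsTreeRouting.isRegulator_iff (h : IsTreeRouting r P) (hJ : IsInputPath J)
    {w z : Fin n → ℝ} (hw : ∀ j, 0 ≤ w j) (hz : (1 - Pᵀ) *ᵥ z = w) {L : ℝ≥0 → Fin n → ℝ} (j : Fin n)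
    (hL : ∀ i < j, IsRegulator (fun t => z i + freeProcess r P J t i) fun t => L t i) :
    IsRegulator (fun t => w j + netput r P J t j + (((1 - Pᵀ) *ᵥ L t) j - L t j))
        (fun t => L t j) ↔
      IsRegulator (fun t => z j + freeProcess r P J t j) fun t => L t j := by
  have hwz : w j = ((1 - Pᵀ) *ᵥ z) j := by rw [hz]
  have hnet : ∀ t, netput r P J t j = ((1 - Pᵀ) *ᵥ freeProcess r P J t) j := fun t => by
    rw [h.mulVec_freeProcess_eq]
  rcases h.root_or_feeder j with hR | ⟨i, hij, hp, hR⟩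
  · simp only [hR] at hwz hnet ⊢
    simp only [hwz, hnet, sub_self, add_zero]
  · have h1 := isRegulator_feed_iff (L₂ := fun t => L t j) (hL i hij) hp
      (a := fun t => w j + netput r P J t j)
      (fun s t hst => add_le_add_right (h.monotone_netput hJ hp hij hR hst) _)
      (by simpa [netput_zero hJ.zero] using hw j)
    have e1 : (fun t => w j + netput r P J t j + (((1 - Pᵀ) *ᵥ L t) j - L t j)) =
        fun t => w j + netput r P J t j - P i j * L t i := by
      funext t; rw [hR]; ring
    -- This is row `j` of `(I - P')(z + X) = w + Y`.
    have e2 : (fun t => z j + freeProcess r P J t j) = fun t =>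
        w j + netput r P J t j + P i j * (z i + freeProcess r P J t i) := by
      funext t; rw [hwz, hnet, hR, hR]; ring
    rw [e1, e2]
    exact h1

/-- Uniqueness, by strong induction on the station: once the upstream regulators are known, station
`j` solves a one-dimensional problem whose regulator `isRegulator_iff` expresses by `z j + X_j`
alone. -/
theorem IsSkorokhodSolution.content_eq_mulVec (h : IsTreeRouting r P) (hJ : IsInputPath J)
    {w : Fin n → ℝ} {W L : ℝ≥0 → Fin n → ℝ}
    (hWL : IsSkorokhodSolution (1 - Pᵀ) (netput r P J) w W L) (t : ℝ≥0) :
    W t = (1 - Pᵀ) *ᵥ aggregateContent ((1 - Pᵀ)⁻¹ *ᵥ w) (freeProcess r P J) t := by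
  set z := (1 - Pᵀ)⁻¹ *ᵥ w with hz_def
  have hz : (1 - Pᵀ) *ᵥ z = w := mulVec_inv_mulVec h.routing_upper w
  have hw : ∀ j, 0 ≤ w j := fun j => by
    have := hWL.content_nonneg 0 j
    rwa [hWL.content_zero] at this
  have hcomp : ∀ j, ∫⁻ t, ENNReal.ofReal (W t j) ∂(hWL.regulator_mono j).stieltjesFunction.measure
      = 0 := fun j => by
    have h1 := hWL.complementarity
    rw [Finset.sum_eq_zero_iff] at h1
    exact h1 j (Finset.mem_univ j)
  have hreg : ∀ j, IsRegulator (fun t => z j + freeProcess r P J t j) fun t => L t j := by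
    intro j
    induction j using WellFoundedLT.induction with
    | ind j ih =>
      rw [← h.isRegulator_iff hJ hw hz j ih]
      have hWj : ∀ t, w j + netput r P J t j + (((1 - Pᵀ) *ᵥ L t) j - L t j) + L t j = W t j := by
        intro t
        rw [hWL.content_eq t]
        simp only [Pi.add_apply]
        ring
      refine isRegulator_of_complementarity ?_ (hWL.regulator_mono j)
        (fun t => continuousWithinAt_pi.1 (hWL.cadlag_regulator.right_continuous t) j)
        (by simp [hWL.regulator_zero]) (fun t => by rw [hWj]; exact hWL.content_nonneg t j) ?_
      · have h1 : IsCadlag fun t => W t + -(L t) :=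
          hWL.cadlag_content.add (hWL.cadlag_regulator.comp_continuous continuous_neg)
        convert! h1.isRegularPath j using 2 with t
        rw [Pi.add_apply, Pi.neg_apply, ← hWj]
        ring
      · simp only [hWj]
        exact hcomp j
  have hcontent : aggregateContent z (freeProcess r P J) t = z + freeProcess r P J t + L t := by
    funext j
    have h1 := (isRegulator_aggregateContent (isCadlag_freeProcess hJ.cadlag) z j).eq (hreg j) t
    simp only [Pi.add_apply]
    linarith
  rw [hcontent, Matrix.mulVec_add, Matrix.mulVec_add, hz, h.mulVec_freeProcess_eq, hWL.content_eq t]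

/-- Existence: `isRegulator_iff` read backwards makes each coordinate the regulator of its own
station's netput, whence nonnegativity and complementarity. -/
theorem IsTreeRouting.isSkorokhodSolution (h : IsTreeRouting r P) (hJ : IsInputPath J)
    {w : Fin n → ℝ} (hw : ∀ j, 0 ≤ w j) :
    IsSkorokhodSolution (1 - Pᵀ) (netput r P J) w
      (fun t => (1 - Pᵀ) *ᵥ aggregateContent ((1 - Pᵀ)⁻¹ *ᵥ w) (freeProcess r P J) t)
      (fun t => aggregateContent ((1 - Pᵀ)⁻¹ *ᵥ w) (freeProcess r P J) t - (1 - Pᵀ)⁻¹ *ᵥ w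
        - freeProcess r P J t) := by
  set z := (1 - Pᵀ)⁻¹ *ᵥ w with hz_def
  set x := freeProcess r P J with hx_def
  set L : ℝ≥0 → Fin n → ℝ := fun t => aggregateContent z x t - z - x t with hL_def
  have hz : (1 - Pᵀ) *ᵥ z = w := mulVec_inv_mulVec h.routing_upper w
  have hx : IsCadlag x := isCadlag_freeProcess hJ.cadlag
  have hreg : ∀ j, IsRegulator (fun t => z j + x t j) fun t => L t j :=
    isRegulator_aggregateContent hx z
  have hW : ∀ t, (1 - Pᵀ) *ᵥ aggregateContent z x t = w + netput r P J t + (1 - Pᵀ) *ᵥ L t := by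
    intro t
    rw [← hz, ← h.mulVec_freeProcess_eq, ← Matrix.mulVec_add, ← Matrix.mulVec_add]
    congr 1
    simp only [hL_def]
    abel
  have hreg' : ∀ j, IsRegulator
      (fun t => w j + netput r P J t j + (((1 - Pᵀ) *ᵥ L t) j - L t j)) fun t => L t j :=
    fun j => (h.isRegulator_iff hJ hw hz j fun i _ => hreg i).2 (hreg j)
  have hmono : ∀ j, Monotone fun t => L t j := fun j => (hreg j).monotone
  have hLc : IsCadlag L := by
    refine isCadlag_of_monotone hmono fun j => (hreg j).right_continuous ?_
    have h1 : IsCadlag fun t => z + x t := (isCadlag_of_continuous continuous_const).add hx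
    exact h1.isRegularPath j
  have hWc : IsCadlag fun t => (1 - Pᵀ) *ᵥ aggregateContent z x t := by
    simp only [hW]
    exact ((isCadlag_of_continuous continuous_const).add (isCadlag_netput hJ.cadlag)).add
      (isCadlag_mulVec hLc _)
  have hWj : ∀ t j, ((1 - Pᵀ) *ᵥ aggregateContent z x t) j =
      w j + netput r P J t j + (((1 - Pᵀ) *ᵥ L t) j - L t j) + L t j := by
    intro t j
    rw [hW t]
    simp only [Pi.add_apply]
    ring
  have hyr : ∀ j, IsRegularPath
      (fun t => w j + netput r P J t j + (((1 - Pᵀ) *ᵥ L t) j - L t j)) := by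
    intro j
    have h1 : IsCadlag fun t => (1 - Pᵀ) *ᵥ aggregateContent z x t + -(L t) :=
      hWc.add (hLc.comp_continuous continuous_neg)
    convert! h1.isRegularPath j using 2 with t
    rw [Pi.add_apply, Pi.neg_apply, hWj]
    ring
  -- The station's path starts at `w j - p_ij L_i(0)`, so the feeder's regulator must vanish at `0`
  -- first.
  have hL0 : L 0 = 0 := by
    funext j
    induction j using WellFoundedLT.induction with
    | ind j ih =>
      refine (hreg' j).zero ?_
      rcases h.root_or_feeder j with hR | ⟨i, hij, hp, hR⟩
      · simpa [hR, netput_zero hJ.zero] using hw j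
      · have := ih i hij
        simp only [Pi.zero_apply] at this
        simp only [hR, netput_zero hJ.zero, this]
        simpa using hw j
  refine ⟨hWc, hLc, hW, fun t j => ?_, ?_, hL0, hmono, Finset.sum_eq_zero fun j _ => ?_⟩
  · have := (hreg' j).neg_le (le_refl t)
    rw [hWj]
    linarith
  · rw [hW, hL0, netput_zero hJ.zero]
    simp
  · simp only [hWj]
    exact (hreg' j).complementarity (hyr j) (hmono j)

/-- The aggregated netput inherits the routing inequalities. -/
theorem IsTreeRouting.mulVec_iSup_nonneg (h : IsTreeRouting r P) (hJ : IsInputPath J)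
    (hb : ∀ j, BddAbove (Set.range fun t => freeProcess r P J t j)) (j : Fin n) :
    0 ≤ ((1 - Pᵀ) *ᵥ supFreeProcess r P J) j := by
  have h0 : ∀ j, 0 ≤ supFreeProcess r P J j := fun j => by
    refine le_ciSup_of_le (hb j) 0 ?_
    simp [freeProcess_zero hJ.zero]
  rcases h.root_or_feeder j with hR | ⟨i, hij, hp, hR⟩
  · rw [hR]; exact h0 j
  · rw [hR, sub_nonneg, mul_comm, ← le_div_iff₀ hp]
    -- Already `p_ij X_i(t) ≤ X_j(t)` for each `t`, because `X_j - p_ij X_i = Y_j` is nondecreasing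
    -- from `0`.
    refine ciSup_le fun t => ?_
    rw [le_div_iff₀ hp]
    refine le_trans ?_ (le_ciSup (hb j) t)
    have h1 := h.monotone_netput hJ hp hij hR (zero_le : 0 ≤ t)
    simp only [← h.mulVec_freeProcess_eq, hR, freeProcess_zero hJ.zero] at h1
    simp only [Pi.zero_apply] at h1
    linarith

end Tree

end Deterministic

/-! ### Shift, reversal and independence for Lévy processes -/

section IncrementLaws

variable {n : ℕ} {Ω : Type*} [MeasurableSpace Ω] {μ : Measure Ω} {X : ℝ≥0 → Ω → Fin n → ℝ}

section Law

/-- Values at the times of `I` become partial sums of increments along one monotone sequence from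
`0`; repetitions are harmless. -/
theorem exists_monotone_enumeration (I : Finset ℝ≥0) :
    ∃ e : ℕ → ℝ≥0, Monotone e ∧ e 0 = 0 ∧ (∀ k, e k ∈ insert 0 I) ∧
      ∃ N, ∀ i ∈ I, ∃ k ≤ N, e k = i := by
  induction I using Finset.induction_on_max with
  | empty => exact ⟨fun _ => 0, monotone_const, rfl, by simp, 0, by simp⟩
  | insert a s hs ih =>
    obtain ⟨e, hm, h0, hmem, N, hN⟩ := ih
    have hea : ∀ k, e k ≤ a := fun k => by
      rcases Finset.mem_insert.1 (hmem k) with h | h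
      · rw [h]; exact zero_le
      · exact (hs _ h).le
    refine ⟨fun k => if k ≤ N then e k else a, ?_, by simp [h0], fun k => ?_, N + 1, fun i hi => ?_⟩
    · intro k l hkl
      by_cases hl : l ≤ N
      · simp only [hl, hkl.trans hl, if_true]; exact hm hkl
      · by_cases hk : k ≤ N
        · simp only [hl, hk, if_true, if_false]; exact hea k
        · simp [hl, hk]
    · by_cases hk : k ≤ N
      · have := hmem k
        simp only [hk, if_true, Finset.mem_insert] at this ⊢
        tauto
      · simp [hk]
    · rcases Finset.mem_insert.1 hi with rfl | hi
      · exact ⟨N + 1, le_rfl, by simp⟩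
      · obtain ⟨k, hk, rfl⟩ := hN i hi
        exact ⟨k, hk.trans (Nat.le_succ N), by simp [hk]⟩

/-- The law of a process with independent increments is determined by the laws of its
increments. -/
theorem identDistrib_of_hasIndepIncrements [IsProbabilityMeasure μ]
    {A B : ℝ≥0 → Ω → Fin n → ℝ} (hAm : ∀ t, Measurable (A t)) (hBm : ∀ t, Measurable (B t))
    (hA : HasIndepIncrements A μ) (hB : HasIndepIncrements B μ)
    (hA0 : ∀ᵐ ω ∂μ, A 0 ω = 0) (hB0 : ∀ᵐ ω ∂μ, B 0 ω = 0)
    (hAB : ∀ s t, s ≤ t → IdentDistrib (fun ω => A t ω - A s ω) (fun ω => B t ω - B s ω) μ μ) :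
    IdentDistrib (fun ω t => A t ω) (fun ω t => B t ω) μ μ := by
  refine (identDistrib_iff_forall_finset_identDistrib
    (measurable_pi_lambda _ hAm).aemeasurable (measurable_pi_lambda _ hBm).aemeasurable).2
    fun I => ?_
  obtain ⟨e, hm, h0, -, N, hN⟩ := exists_monotone_enumeration I
  choose! k _ hk using hN
  have hinc := IdentDistrib.pi (fun l : ℕ => hAB _ _ (hm (Nat.le_succ l))) (hA.nat hm) (hB.nat hm)
  have hmeas : Measurable fun (d : ℕ → Fin n → ℝ) (i : I) => ∑ l ∈ Finset.range (k i), d l := by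
    fun_prop
  -- Telescoping recovers the values of the process from its increments, as it starts at `0`.
  have hrec : ∀ {C : ℝ≥0 → Ω → Fin n → ℝ}, (∀ t, Measurable (C t)) → (∀ᵐ ω ∂μ, C 0 ω = 0) →
      IdentDistrib (fun ω => I.restrict fun t => C t ω)
        (fun ω (i : I) => ∑ l ∈ Finset.range (k i), (C (e (l + 1)) ω - C (e l) ω)) μ μ := by
    intro C hC hC0
    refine IdentDistrib.of_ae_eq ?_ ?_
    · exact (measurable_pi_lambda (fun ω => I.restrict fun t => C t ω) fun i => hC i).aemeasurable
    · filter_upwards [hC0] with ω hω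
      funext i
      rw [Finset.sum_range_sub (fun l => C (e l) ω), h0, hω, sub_zero, hk i i.2]
      rfl
  exact ((hrec hAm hA0).trans (hinc.comp hmeas)).trans (hrec hBm hB0).symm

theorem IsLevyProcess.identDistrib_sub (hX : IsLevyProcess X μ) {s t : ℝ≥0} (hst : s ≤ t) :
    IdentDistrib (fun ω => X t ω - X s ω) (X (t - s)) μ μ := by
  have h := hX.stationary_increments s (t - s)
  rwa [add_tsub_cancel_of_le hst] at h

theorem IsLevyProcess.identDistrib_sub_sub (hX : IsLevyProcess X μ) {s t s' t' : ℝ≥0}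
    (hst : s ≤ t) (hst' : s' ≤ t') (h : t - s = t' - s') :
    IdentDistrib (fun ω => X t ω - X s ω) (fun ω => X t' ω - X s' ω) μ μ :=
  (hX.identDistrib_sub hst).trans (h ▸ (hX.identDistrib_sub hst').symm)

/-- The increments of a Lévy process after time `h` are distributed like the process. -/
theorem IsLevyProcess.identDistrib_shift [IsProbabilityMeasure μ] (hX : IsLevyProcess X μ)
    (h : ℝ≥0) :
    IdentDistrib (fun ω u => X (h + u) ω - X h ω) (fun ω u => X u ω) μ μ := by
  refine identDistrib_of_hasIndepIncrements (fun u => (hX.measurable _).sub (hX.measurable _))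
    hX.measurable ?_ hX.indep_increments (by simp) hX.zero fun s t hst => ?_
  · intro m t ht
    simp only [sub_sub_sub_cancel_right]
    exact hX.indep_increments m (fun i => h + t i) fun i j hij => add_le_add_right (ht hij) h
  · simp only [sub_sub_sub_cancel_right]
    exact hX.identDistrib_sub_sub (add_le_add_right hst h) hst (add_tsub_add_eq_tsub_left h t s)

/-- Time reversal of a Lévy process on `[0, t]`. -/
theorem IsLevyProcess.identDistrib_reverse [IsProbabilityMeasure μ] (hX : IsLevyProcess X μ)
    (t : ℝ≥0) :
    IdentDistrib (fun ω s => X t ω - X (t - s) ω) (fun ω s => X (min s t) ω) μ μ := by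
  refine identDistrib_of_hasIndepIncrements (fun u => (hX.measurable _).sub (hX.measurable _))
    (fun s => hX.measurable _) ?_ ?_ (by simp) (by simpa using hX.zero) fun s u hsu => ?_
  · intro m τ hτ
    simp only [sub_sub_sub_cancel_left]
    -- The reflected times decrease, so the grid is read backwards through `Fin.rev`.
    have h1 := (hX.indep_increments m (fun i => t - τ i.rev)
      fun i j hij => tsub_le_tsub_left (hτ (Fin.rev_le_rev.2 hij)) t).precomp
        (g := Fin.rev) Fin.rev_injective
    simpa [Function.comp_def, Fin.rev_succ, Fin.rev_castSucc] using h1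
  · intro m τ hτ
    exact hX.indep_increments m (fun i => min (τ i) t) fun i j hij => min_le_min_right t (hτ hij)
  · simp only [sub_sub_sub_cancel_left]
    refine hX.identDistrib_sub_sub (tsub_le_tsub_left hsu t) (min_le_min_right t hsu) ?_
    -- Subtraction in `ℝ≥0` truncates: the reversed process freezes after time `t`, just as `X (min
    -- s t)` does.
    rw [← NNReal.coe_inj]
    rw [NNReal.coe_sub (tsub_le_tsub_left hsu t), NNReal.coe_sub (min_le_min_right t hsu),
      NNReal.coe_min, NNReal.coe_min, NNReal.coe_sub_def, NNReal.coe_sub_def]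
    have h1 : (s : ℝ) ≤ u := hsu
    rcases le_total (u : ℝ) t with h2 | h2
    · rw [max_eq_left (by linarith), max_eq_left (by linarith), min_eq_left h2,
        min_eq_left (by linarith)]
      ring
    · rcases le_total (s : ℝ) t with h3 | h3
      · rw [max_eq_left (by linarith), max_eq_right (by linarith), min_eq_right h2,
          min_eq_left h3]
        ring
      · rw [max_eq_right (by linarith), max_eq_right (by linarith), min_eq_right h2,
          min_eq_right h3]
        ring

/-- The past of a Lévy process is independent of its future increments. -/
theorem IsLevyProcess.indepFun_past_future [IsProbabilityMeasure μ] (hX : IsLevyProcess X μ)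
    (h : ℝ≥0) :
    IndepFun (fun ω (s : Set.Iic h) => X s ω) (fun ω u => X (h + u) ω - X h ω) μ := by
  refine IndepFun.process_indepFun_process (X := fun (s : Set.Iic h) => X s)
    (Y := fun u ω => X (h + u) ω - X h ω) (fun s => hX.measurable _)
    (fun u => (hX.measurable _).sub (hX.measurable _)) fun I J => ?_
  obtain ⟨e, hem, he0, hmem, N, hN⟩ := exists_monotone_enumeration (I.image Subtype.val)
  obtain ⟨f, hfm, hf0, -, M, hM⟩ := exists_monotone_enumeration J
  have heh : ∀ k, e k ≤ h := fun k => by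
    rcases Finset.mem_insert.1 (hmem k) with h1 | h1
    · rw [h1]; exact zero_le
    · obtain ⟨i, -, hi⟩ := Finset.mem_image.1 h1
      rw [← hi]; exact i.2
  have hN' : ∀ i : I, ∃ k ≤ N, e k = (i : Set.Iic h) := fun i =>
    hN _ (Finset.mem_image_of_mem _ i.2)
  have hM' : ∀ j : J, ∃ k ≤ M, f k = j := fun j => hM _ j.2
  choose k hkN hk using hN'
  choose l hlM hl using hM'
  -- One grid carries past and future. Increment number `N`, from `e N` to `h`, bridges the two and
  -- belongs to neither block.
  set u : ℕ → ℝ≥0 := fun m => if m ≤ N then e m else h + f (m - (N + 1)) with hu_def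
  have hum : Monotone u := by
    intro a b hab
    by_cases hb : b ≤ N
    · simp only [hu_def, hb, hab.trans hb, if_true]; exact hem hab
    · by_cases ha : a ≤ N
      · simp only [hu_def, hb, ha, if_true, if_false]
        exact (heh a).trans (le_add_of_nonneg_right zero_le)
      · simp only [hu_def, hb, ha, if_false]
        exact add_le_add_right (hfm (by omega)) h
  have hind := (hX.indep_increments.nat hum).indepFun_finset (Finset.range N)
    (Finset.Ico (N + 1) (N + 1 + M))
    (Finset.disjoint_left.2 fun a ha hb => by
      have := Finset.mem_range.1 ha
      have := (Finset.mem_Ico.1 hb).1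
      omega)
    fun i => (hX.measurable _).sub (hX.measurable _)
  have h1 : Measurable fun (d : Finset.range N → Fin n → ℝ) (i : I) =>
      ∑ m : Fin (k i), d ⟨m, Finset.mem_range.2 (m.2.trans_le (hkN i))⟩ := by fun_prop
  have h2 : Measurable fun (d : Finset.Ico (N + 1) (N + 1 + M) → Fin n → ℝ) (j : J) =>
      ∑ m : Fin (l j), d ⟨N + 1 + m, Finset.mem_Ico.2
        ⟨Nat.le_add_right _ _, Nat.add_lt_add_left (m.2.trans_le (hlM j)) _⟩⟩ := by fun_prop
  refine (hind.comp h1 h2).congr ?_ (Eventually.of_forall fun ω => ?_)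
  · filter_upwards [hX.zero] with ω hω
    funext i
    simp only [Function.comp_apply]
    rw [Fin.sum_univ_eq_sum_range (fun m => X (u (m + 1)) ω - X (u m) ω),
      Finset.sum_range_sub (fun m => X (u m) ω)]
    simp [hu_def, hkN i, hk, he0, hω]
  · funext j
    simp only [Function.comp_apply]
    rw [Fin.sum_univ_eq_sum_range (fun m => X (u (N + 1 + m + 1)) ω - X (u (N + 1 + m)) ω)]
    have h3 := Finset.sum_range_sub (fun m => X (u (N + 1 + m)) ω) (l j)
    simp only [← add_assoc] at h3
    rw [h3]
    have h4 : ∀ m, u (N + 1 + m) = h + f m := fun m => by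
      simp only [hu_def]
      rw [if_neg (by omega), Nat.add_sub_cancel_left]
    rw [h4, h4, hl, hf0, add_zero]

end Law

end IncrementLaws

/-! ### Almost sure finiteness of the supremum -/

section Maximum

variable {n : ℕ} {Ω : Type*} [MeasurableSpace Ω] {μ : Measure Ω} {X : ℝ≥0 → Ω → Fin n → ℝ}

section Drift

/-- At integer times the process is a random walk with negative mean, so the strong law applies. -/
theorem IsLevyProcess.tendsto_atBot (hX : IsLevyProcess X μ) (j : Fin n)
    (hint : Integrable (fun ω => X 1 ω j) μ) (hneg : ∫ ω, X 1 ω j ∂μ < 0) :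
    ∀ᵐ ω ∂μ, Tendsto (fun k : ℕ => X k ω j) atTop atBot := by
  have hmono : Monotone fun k : ℕ => (k : ℝ≥0) := Nat.mono_cast
  have heval : Measurable fun v : Fin n → ℝ => v j := measurable_pi_apply j
  set Y : ℕ → Ω → ℝ := fun k ω => X ((k + 1 : ℕ) : ℝ≥0) ω j - X (k : ℝ≥0) ω j with hY
  have hYind : iIndepFun Y μ :=
    (hX.indep_increments.nat hmono).comp (fun _ v => v j) fun _ => heval
  have hY0 : Y 0 =ᵐ[μ] fun ω => X 1 ω j := by
    filter_upwards [hX.zero] with ω hω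
    simp [hY, hω]
  have hYid : ∀ i, IdentDistrib (Y i) (Y 0) μ μ := fun i =>
    (hX.identDistrib_sub_sub (hmono (Nat.le_succ i)) (hmono (Nat.le_succ 0)) (by simp)).comp heval
  have hslln := strong_law_ae_real Y (hint.congr hY0.symm)
    (fun a b hab => hYind.indepFun hab) hYid
  rw [integral_congr_ae hY0] at hslln
  filter_upwards [hslln, hX.zero] with ω hω h0
  have h1 := hω.neg_mul_atTop hneg tendsto_natCast_atTop_atTop
  refine h1.congr' ?_
  filter_upwards [eventually_gt_atTop 0] with k hk
  have hk' : (k : ℝ) ≠ 0 := by exact_mod_cast hk.ne'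
  rw [div_mul_cancel₀ _ hk', Finset.sum_range_sub (fun k : ℕ => X (k : ℝ≥0) ω j)]
  simp [h0]

/-- A bound uniform in `u ≤ 1`, as the maximal inequality requires; it exists because càdlàg paths
are bounded on `[0, 1]`. -/
theorem IsLevyProcess.exists_lower_quantile [IsProbabilityMeasure μ] (hX : IsLevyProcess X μ)
    (j : Fin n) : ∃ a : ℝ, ∀ u ≤ 1, 1 / 2 ≤ μ {ω | -a < X u ω j} := by
  by_contra! hcon
  choose u hu1 hu using fun m : ℕ => hcon m
  set A : ℕ → Set Ω := fun m => {ω | ∀ l, m ≤ l → -(l : ℝ) < X (u l) ω j} with hA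
  have hmono : Monotone A := fun m m' hm ω hω l hl => hω l (hm.trans hl)
  have hle : ∀ m, μ (A m) ≤ 1 / 2 := fun m =>
    (measure_mono fun ω (hω : ω ∈ A m) => hω m le_rfl).trans (hu m).le
  have hfull : μ (⋃ m, A m) = 1 := by
    rw [← measure_univ (μ := μ)]
    refine measure_congr (eventuallyEq_univ.2 ?_)
    filter_upwards [hX.cadlag] with ω hω
    obtain ⟨C, hC⟩ := (hω.isRegularPath j).bounded 1
    obtain ⟨m, hm⟩ := exists_nat_gt C
    refine Set.mem_iUnion.2 ⟨m, fun l hl => ?_⟩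
    have h1 := (abs_le.1 (hC _ (hu1 l))).1
    have h2 : (m : ℝ) ≤ l := by exact_mod_cast hl
    linarith
  rw [hmono.measure_iUnion] at hfull
  have : ⨆ m, μ (A m) ≤ 1 / 2 := iSup_le hle
  rw [hfull, one_div] at this
  exact absurd this (not_le.2 ENNReal.one_half_lt_one)

/-- Ottaviani's maximal inequality: an excursion above a high level is still visible at the next
integer time with probability at least one half. -/
theorem IsLevyProcess.measure_exists_gt_le [IsProbabilityMeasure μ] (hX : IsLevyProcess X μ)
    (j : Fin n) {a : ℝ} (ha : ∀ u ≤ 1, 1 / 2 ≤ μ {ω | -a < X u ω j}) (C : ℝ) (F : Finset ℝ≥0) :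
    μ {ω | ∃ i ∈ F, C < X i ω j} ≤ 2 * μ {ω | ∃ k : ℕ, C - a < X k ω j} := by
  have hXj : ∀ i, Measurable fun ω => X i ω j := fun i =>
    (measurable_pi_apply j).comp (hX.measurable i)
  -- `E i`: the first passage above `C` within `F` is at `i`. `G i`: the path falls by less than `a`
  -- from `i` to the next integer. The first depends on the past of `i`, the second on its future.
  set E : ℝ≥0 → Set Ω := fun i => {ω | C < X i ω j ∧ ∀ s ∈ F, s < i → X s ω j ≤ C} with hE
  set G : ℝ≥0 → Set Ω := fun i => {ω | -a < X (⌈i⌉₊ : ℝ≥0) ω j - X i ω j} with hG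
  have hEm : ∀ i, MeasurableSet (E i) := fun i => by
    refine (measurableSet_lt measurable_const (hXj i)).inter ?_
    have : {ω | ∀ s ∈ F, s < i → X s ω j ≤ C} = ⋂ s ∈ F, ⋂ (_ : s < i), {ω | X s ω j ≤ C} := by
      ext ω; simp
    change MeasurableSet {ω | ∀ s ∈ F, s < i → X s ω j ≤ C}
    rw [this]
    exact Finset.measurableSet_biInter _ fun s _ => MeasurableSet.iInter fun _ =>
      measurableSet_le (hXj s) measurable_const
  have hGm : ∀ i, MeasurableSet (G i) := fun i =>
    measurableSet_lt measurable_const ((hXj _).sub (hXj i))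
  have hGle : ∀ i, 1 / 2 ≤ μ (G i) := fun i => by
    have hi : i ≤ (⌈i⌉₊ : ℝ≥0) := Nat.le_ceil i
    have h1 := (hX.identDistrib_sub hi).measure_mem_eq
      (s := {v : Fin n → ℝ | -a < v j}) (measurableSet_lt measurable_const (measurable_pi_apply j))
    refine (ha ((⌈i⌉₊ : ℝ≥0) - i) ?_).trans h1.symm.le
    rw [tsub_le_iff_left]
    exact (Nat.ceil_lt_add_one zero_le).le
  have hind : ∀ i, μ (E i ∩ G i) = μ (E i) * μ (G i) := fun i => by
    have h1 := hX.indepFun_past_future i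
    have hEi : E i = (fun ω (s : Set.Iic i) => X s ω) ⁻¹' {p | C < p ⟨i, Set.self_mem_Iic⟩ j ∧
        ∀ s ∈ F, ∀ hs : s < i, p ⟨s, hs.le⟩ j ≤ C} := by
      ext ω; simp [hE]
    have hGi : G i = (fun ω u => X (i + u) ω - X i ω) ⁻¹'
        {p : ℝ≥0 → Fin n → ℝ | -a < p ((⌈i⌉₊ : ℝ≥0) - i) j} := by
      ext ω
      simp [hG, add_tsub_cancel_of_le (Nat.le_ceil i)]
    rw [hEi, hGi]
    refine h1.measure_inter_preimage_eq_mul _ _ ?_ ?_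
    · have hi : MeasurableSet {p : Set.Iic i → Fin n → ℝ | C < p ⟨i, Set.self_mem_Iic⟩ j} :=
        measurableSet_lt measurable_const (by fun_prop)
      refine hi.inter ?_
      have : {p : Set.Iic i → Fin n → ℝ | ∀ s ∈ F, ∀ hs : s < i, p ⟨s, hs.le⟩ j ≤ C} =
          ⋂ s ∈ F, ⋂ (hs : s < i), {p | p ⟨s, hs.le⟩ j ≤ C} := by
        ext ω; simp
      change MeasurableSet {p : Set.Iic i → Fin n → ℝ | ∀ s ∈ F, ∀ hs : s < i, p ⟨s, hs.le⟩ j ≤ C}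
      rw [this]
      exact Finset.measurableSet_biInter _ fun s _ => MeasurableSet.iInter fun _ =>
        measurableSet_le (by fun_prop) measurable_const
    · exact measurableSet_lt measurable_const (by fun_prop)
  have hcover : {ω | ∃ i ∈ F, C < X i ω j} ⊆ ⋃ i ∈ F, E i := by
    rintro ω ⟨i, hi, hiC⟩
    have hne : (F.filter fun i => C < X i ω j).Nonempty := ⟨i, Finset.mem_filter.2 ⟨hi, hiC⟩⟩
    obtain ⟨i₀, hi₀, hmin⟩ := Finset.exists_minimal hne
    have hm := Finset.mem_filter.1 hi₀
    refine Set.mem_biUnion hm.1 ⟨hm.2, fun s hs hsi => ?_⟩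
    by_contra! hlt
    exact absurd (hmin (Finset.mem_filter.2 ⟨hs, hlt⟩) hsi.le) (not_le.2 hsi)
  have hdisj : Set.PairwiseDisjoint (F : Set ℝ≥0) fun i => E i ∩ G i := by
    intro i hi k hk hik
    refine Set.disjoint_left.2 fun ω h1 h2 => ?_
    rcases lt_or_gt_of_ne hik with h | h
    · exact absurd (h2.1.2 i hi h) (not_le.2 h1.1.1)
    · exact absurd (h1.1.2 k hk h) (not_le.2 h2.1.1)
  have hsub : (⋃ i ∈ F, E i ∩ G i) ⊆ {ω | ∃ k : ℕ, C - a < X k ω j} := by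
    refine Set.iUnion₂_subset fun i _ ω hω => ⟨⌈i⌉₊, ?_⟩
    have h1 : C < X i ω j := hω.1.1
    have h2 : -a < X (⌈i⌉₊ : ℝ≥0) ω j - X i ω j := hω.2
    linarith
  calc μ {ω | ∃ i ∈ F, C < X i ω j}
      ≤ ∑ i ∈ F, μ (E i) := (measure_mono hcover).trans (measure_biUnion_finset_le _ _)
    _ ≤ ∑ i ∈ F, 2 * μ (E i ∩ G i) := by
        refine Finset.sum_le_sum fun i _ => ?_
        rw [hind]
        calc μ (E i) = 2 * (μ (E i) * (1 / 2)) := by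
              rw [mul_comm (μ (E i)), ← mul_assoc, one_div,
                ENNReal.mul_inv_cancel two_ne_zero ENNReal.ofNat_ne_top, one_mul]
          _ ≤ 2 * (μ (E i) * μ (G i)) := by gcongr; exact hGle i
    _ = 2 * μ (⋃ i ∈ F, E i ∩ G i) := by
        rw [← Finset.mul_sum, measure_biUnion_finset hdisj fun i _ => (hEm i).inter (hGm i)]
    _ ≤ _ := by gcongr

/-- The maximal inequality is uniform in the finite set, so it passes to all rational times;
right-continuity covers the rest. -/
theorem IsLevyProcess.ae_bddAbove [IsProbabilityMeasure μ] (hX : IsLevyProcess X μ) (j : Fin n)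
    (hlim : ∀ᵐ ω ∂μ, Tendsto (fun k : ℕ => X k ω j) atTop atBot) :
    ∀ᵐ ω ∂μ, BddAbove (Set.range fun t => X t ω j) := by
  obtain ⟨a, ha⟩ := hX.exists_lower_quantile j
  have hXj : ∀ i, Measurable fun ω => X i ω j := fun i =>
    (measurable_pi_apply j).comp (hX.measurable i)
  have hbound : ∀ C : ℝ, μ {ω | ∃ q : ℚ≥0, C < X q ω j} ≤
      2 * μ {ω | ∃ k : ℕ, C - a < X k ω j} := by
    intro C
    have h1 : {ω | ∃ q : ℚ≥0, C < X q ω j} =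
        ⋃ F : Finset ℚ≥0, {ω | ∃ i ∈ F.image (fun q : ℚ≥0 => (q : ℝ≥0)), C < X i ω j} := by
      ext ω
      simp only [Set.mem_ofPred_eq, Set.mem_iUnion, Finset.mem_image]
      constructor
      · rintro ⟨q, hq⟩
        exact ⟨{q}, q, ⟨q, by simp, rfl⟩, hq⟩
      · rintro ⟨F, _, ⟨q, -, rfl⟩, hq⟩
        exact ⟨q, hq⟩
    rw [h1, Directed.measure_iUnion]
    · exact iSup_le fun F => hX.measure_exists_gt_le j ha C _
    · refine directed_of_isDirected_le fun F F' hF ω hω => ?_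
      obtain ⟨i, hi, h⟩ := hω
      exact ⟨i, Finset.image_subset_image hF hi, h⟩
  set G : ℕ → Set Ω := fun m => {ω | ∃ k : ℕ, (m : ℝ) - a < X k ω j} with hG
  have hGm : ∀ m, MeasurableSet (G m) := fun m => by
    have : G m = ⋃ k : ℕ, {ω | (m : ℝ) - a < X k ω j} := by ext; simp [hG]
    rw [this]
    exact MeasurableSet.iUnion fun k => measurableSet_lt measurable_const (hXj _)
  have hGanti : Antitone G := fun m m' hm ω hω => by
    obtain ⟨k, hk⟩ := hω
    have : (m : ℝ) ≤ m' := by exact_mod_cast hm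
    exact ⟨k, by linarith⟩
  have hG0 : μ (⋂ m, G m) = 0 := by
    refine measure_mono_null (fun ω hω => ?_) (ae_iff.1 hlim)
    intro hω'
    obtain ⟨C, hC⟩ : BddAbove (Set.range fun k : ℕ => X k ω j) :=
      bddAbove_range_of_tendsto_atTop_atBot hω'
    obtain ⟨m, hm⟩ := exists_nat_gt (C + a)
    obtain ⟨k, hk⟩ := Set.mem_iInter.1 hω m
    have h1 : X k ω j ≤ C := hC ⟨k, rfl⟩
    linarith
  have hGlim : Tendsto (fun m => 2 * μ (G m)) atTop (𝓝 0) := by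
    have h1 := tendsto_measure_iInter_atTop (fun m => (hGm m).nullMeasurableSet) hGanti
      ⟨0, measure_ne_top μ _⟩
    rw [hG0] at h1
    simpa using ENNReal.Tendsto.const_mul h1 (Or.inr ENNReal.ofNat_ne_top)
  have hnull : μ {ω | ∀ m : ℕ, ∃ q : ℚ≥0, (m : ℝ) < X q ω j} = 0 := by
    refine le_antisymm (ge_of_tendsto' hGlim fun m => ?_) zero_le
    refine le_trans (measure_mono ?_) (hbound m)
    exact fun ω (hω : ∀ m : ℕ, ∃ q : ℚ≥0, (m : ℝ) < X q ω j) => hω m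
  have hae : ∀ᵐ ω ∂μ, ¬ ∀ m : ℕ, ∃ q : ℚ≥0, (m : ℝ) < X q ω j := by
    rw [ae_iff]; simpa only [not_not] using hnull
  filter_upwards [hae, hX.cadlag] with ω hω hc
  push Not at hω
  obtain ⟨m, hm⟩ := hω
  refine ⟨m, ?_⟩
  rintro _ ⟨t, rfl⟩
  exact (forall_nnrat_le_iff (hc.isRegularPath j).right_continuous m).1 hm t

end Drift

/-! ### Path suprema and their time reversal -/

section Supremum

/-- No boundedness is assumed: with equal upper bounds, both families are unbounded together, and
then both suprema take the default value. -/
theorem iSup_eq_iSup_of_forall_le_iff {ι κ : Type*} [Nonempty ι] [Nonempty κ] {f : ι → ℝ}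
    {g : κ → ℝ} (h : ∀ c, (∀ i, f i ≤ c) ↔ ∀ k, g k ≤ c) : ⨆ i, f i = ⨆ k, g k := by
  have hbdd : BddAbove (Set.range f) ↔ BddAbove (Set.range g) := by
    simp only [bddAbove_def, Set.forall_mem_range, h]
  by_cases hf : BddAbove (Set.range f)
  · exact eq_of_forall_ge_iff fun c => by rw [ciSup_le_iff hf, ciSup_le_iff (hbdd.1 hf), h]
  · rw [Real.iSup_of_not_bddAbove hf, Real.iSup_of_not_bddAbove (hbdd.not.1 hf)]

/-- The componentwise supremum of a path over the rational times. -/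
def pathSup (x : ℝ≥0 → Fin n → ℝ) : Fin n → ℝ := fun j => ⨆ q : ℚ≥0, x q j

/-- The componentwise supremum of a path over a countable dense set of times in `[0, t]`. -/
def runningSup (x : ℝ≥0 → Fin n → ℝ) (t : ℝ≥0) : Fin n → ℝ :=
  fun j => ⨆ q : ℚ≥0, x (min (q : ℝ≥0) t) j

/-- The aggregated content at time `t` of a network that starts empty. -/
def reflectedPath (x : ℝ≥0 → Fin n → ℝ) (t : ℝ≥0) : Fin n → ℝ :=
  fun j => ⨆ q : ℚ≥0, (x t j - x (min (q : ℝ≥0) t) j)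

theorem measurable_pathSup : Measurable (pathSup (n := n)) :=
  measurable_pi_lambda _ fun j => Measurable.iSup fun q => by fun_prop

theorem measurable_reflectedPath (t : ℝ≥0) :
    Measurable fun x : ℝ≥0 → Fin n → ℝ => reflectedPath x t :=
  measurable_pi_lambda _ fun j => Measurable.iSup fun q => by fun_prop

theorem measurable_runningSup (t : ℝ≥0) :
    Measurable fun x : ℝ≥0 → Fin n → ℝ => runningSup x t :=
  measurable_pi_lambda _ fun j => Measurable.iSup fun q => by fun_prop

theorem measurable_aggregateContent (t : ℝ≥0) :
    Measurable fun p : (Fin n → ℝ) × (ℝ≥0 → Fin n → ℝ) => aggregateContent p.1 p.2 t := by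
  refine measurable_pi_lambda _ fun j => Measurable.max (by fun_prop) ?_
  exact Measurable.iSup fun q => by fun_prop

variable {x : ℝ≥0 → Fin n → ℝ}

theorem pathSup_apply (hx : IsCadlag x) (j : Fin n) : pathSup x j = ⨆ t, x t j :=
  iSup_eq_iSup_of_forall_le_iff fun c => forall_nnrat_le_iff (hx.isRegularPath j).right_continuous c

theorem pathSup_le_iff (hx : IsCadlag x) {j : Fin n} (hb : BddAbove (Set.range fun t => x t j))
    (c : ℝ) : pathSup x j ≤ c ↔ ∀ t, x t j ≤ c := by
  rw [pathSup_apply hx, ciSup_le_iff hb]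

theorem runningSup_le_iff (hx : IsCadlag x) (t : ℝ≥0) (j : Fin n) (c : ℝ) :
    runningSup x t j ≤ c ↔ ∀ s ≤ t, x s j ≤ c := by
  obtain ⟨C, hC⟩ := (hx.isRegularPath j).bounded t
  rw [runningSup, ciSup_le_iff]
  · exact forall_min_le_iff (f := fun s => x s j) (hx.isRegularPath j).right_continuous t c
  · refine ⟨C, ?_⟩
    rintro _ ⟨q, rfl⟩
    exact (abs_le.1 (hC _ (min_le_right (q : ℝ≥0) t))).2

theorem le_runningSup (hx : IsCadlag x) {s t : ℝ≥0} (hst : s ≤ t) (j : Fin n) :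
    x s j ≤ runningSup x t j :=
  (runningSup_le_iff hx t j _).1 le_rfl s hst

theorem bddAbove_shift {j : Fin n} (hb : BddAbove (Set.range fun t => x t j)) (h : ℝ≥0) :
    BddAbove (Set.range fun u => (x (h + u) - x h) j) := by
  obtain ⟨C, hC⟩ := hb
  refine ⟨C - x h j, ?_⟩
  rintro _ ⟨u, rfl⟩
  have : x (h + u) j ≤ C := hC ⟨h + u, rfl⟩
  simp only [Pi.sub_apply]
  linarith

/-- The pathwise source of the fixed point equation: the supremum is split at time `h`. -/
theorem pathSup_eq_sup (hx : IsCadlag x) (hb : ∀ j, BddAbove (Set.range fun t => x t j))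
    (h : ℝ≥0) : (pathSup (fun u => x (h + u) - x h) + x h) ⊔ runningSup x h = pathSup x := by
  funext j
  refine eq_of_forall_ge_iff fun c => ?_
  rw [Pi.sup_apply, sup_le_iff, runningSup_le_iff hx, Pi.add_apply, pathSup_le_iff hx (hb j),
    ← le_sub_iff_add_le, pathSup_le_iff (hx.shift h) (bddAbove_shift (hb j) h)]
  simp only [Pi.sub_apply]
  constructor
  · rintro ⟨h1, h2⟩ t
    rcases le_total t h with ht | ht
    · exact h2 t ht
    · obtain ⟨u, rfl⟩ := exists_add_of_le ht
      have := h1 u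
      linarith
  · exact fun h1 => ⟨fun u => by have := h1 (h + u); linarith, fun s _ => h1 s⟩

theorem tendsto_runningSup (hx : IsCadlag x) (hb : ∀ j, BddAbove (Set.range fun t => x t j)) :
    Tendsto (fun k : ℕ => runningSup x k) atTop (𝓝 (pathSup x)) := by
  refine tendsto_pi_nhds.2 fun j => tendsto_atTop_isLUB ?_ ?_
  · intro k l hkl
    refine (runningSup_le_iff hx _ j _).2 fun s hs => ?_
    exact le_runningSup hx (hs.trans (Nat.mono_cast hkl)) j
  · refine isLUB_iff_le_iff.2 fun c => ?_
    rw [pathSup_le_iff hx (hb j)]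
    simp only [mem_upperBounds, Set.forall_mem_range, runningSup_le_iff hx]
    constructor
    · exact fun h k s _ => h s
    · intro h t
      obtain ⟨k, hk⟩ := exists_nat_ge t
      exact h k t hk

/-- The content at time `t` of a network that starts empty is distributed like the supremum of the
aggregated netput over `[0, t]`, jointly with the netput at time `t`. -/
theorem IsLevyProcess.identDistrib_reflectedPath [IsProbabilityMeasure μ]
    (hX : IsLevyProcess X μ) (t : ℝ≥0) :
    IdentDistrib (fun ω => (X t ω, reflectedPath (fun s => X s ω) t))
      (fun ω => (X t ω, runningSup (fun s => X s ω) t)) μ μ := by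
  have hpath : Measurable fun ω s => X s ω := measurable_pi_lambda _ hX.measurable
  -- On the reversed path `p s = X t - X (t - s)`, sampling at `t - min q t` gives `X t - X (min q
  -- t)`, the terms of `reflectedPath`.
  have hΦ : Measurable fun p : ℝ≥0 → Fin n → ℝ =>
      (p t, fun j : Fin n => ⨆ q : ℚ≥0, p (t - min (q : ℝ≥0) t) j) := by
    refine Measurable.prodMk (by fun_prop) (measurable_pi_lambda _ fun j => ?_)
    exact Measurable.iSup fun q => by fun_prop
  have h1 := (hX.identDistrib_reverse t).comp hΦ
  refine (IdentDistrib.of_ae_eq ?_ ?_).trans (h1.trans (IdentDistrib.of_ae_eq ?_ ?_))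
  · exact ((hX.measurable t).prodMk ((measurable_reflectedPath t).comp hpath)).aemeasurable
  · filter_upwards [hX.zero] with ω hω
    simp only [Function.comp_apply, tsub_self, hω, sub_zero, Prod.mk.injEq, true_and]
    funext j
    simp only [reflectedPath, tsub_tsub_cancel_of_le (min_le_right _ t), Pi.sub_apply]
  · exact (h1.aemeasurable_snd)
  · filter_upwards [hX.cadlag] with ω hω
    simp only [Function.comp_apply, min_self, Prod.mk.injEq, true_and]
    funext j
    refine iSup_eq_iSup_of_forall_le_iff fun c => ?_
    simp only [min_eq_left (tsub_le_self (a := t))]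
    have hc := (hω.isRegularPath j).right_continuous
    exact (forall_sub_le_iff (f := fun s => X s ω j) hc t c).trans
      (forall_min_le_iff (f := fun s => X s ω j) hc t c).symm

end Supremum

end Maximum

/-! ### Independent initial content -/

section Stationarity

variable {n : ℕ} {Ω : Type*} [MeasurableSpace Ω] {μ : Measure Ω}

section Product

variable {E F G : Type*} [MeasurableSpace E] [MeasurableSpace F] [MeasurableSpace G]

theorem identDistrib_comp_fst [IsProbabilityMeasure μ] {π : Measure E} [IsProbabilityMeasure π]
    {U : Ω → F} (hU : AEMeasurable U μ) :
    IdentDistrib (fun x : Ω × E => U x.1) U (μ.prod π) μ where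
  aemeasurable_fst := hU.comp_quasiMeasurePreserving Measure.quasiMeasurePreserving_fst
  aemeasurable_snd := hU
  map_eq := by
    have h1 : (μ.prod π).map Prod.fst = μ := measurePreserving_fst.map_eq
    conv_rhs => rw [← h1]
    rw [AEMeasurable.map_map_of_aemeasurable (h1.symm ▸ hU) measurable_fst.aemeasurable]
    rfl

theorem identDistrib_comp_snd [IsProbabilityMeasure μ] {π : Measure E} [IsProbabilityMeasure π]
    {U : E → F} (hU : AEMeasurable U π) :
    IdentDistrib (fun x : Ω × E => U x.2) U (μ.prod π) π where
  aemeasurable_fst := hU.comp_quasiMeasurePreserving Measure.quasiMeasurePreserving_snd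
  aemeasurable_snd := hU
  map_eq := by
    have h1 : (μ.prod π).map Prod.snd = π := measurePreserving_snd.map_eq
    conv_rhs => rw [← h1]
    rw [AEMeasurable.map_map_of_aemeasurable (h1.symm ▸ hU) measurable_snd.aemeasurable]
    rfl

theorem map_prodMk_snd [IsProbabilityMeasure μ] {π : Measure E} [IsProbabilityMeasure π]
    {U : Ω → F} (hU : Measurable U) :
    (μ.prod π).map (fun x => (x.2, U x.1)) = π.prod (μ.map U) := by
  have : IsProbabilityMeasure (μ.map U) := Measure.isProbabilityMeasure_map hU.aemeasurable
  have h1 := Measure.map_prod_map π μ measurable_id hU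
  have hm : Measurable fun x : Ω × E => (x.2, U x.1) :=
    measurable_snd.prodMk (hU.comp measurable_fst)
  rw [Measure.map_id] at h1
  rw [h1, ← Measure.prod_swap (μ := π) (ν := μ), Measure.map_map hm measurable_swap]
  rfl

/-- Adjoining an independent coordinate to `U` preserves the independence of `U` and `V`. -/
theorem indepFun_prodMk_snd [IsProbabilityMeasure μ] {π : Measure E} [IsProbabilityMeasure π]
    {U : Ω → F} {V : Ω → G} (hU : Measurable U) (hV : Measurable V) (hUV : IndepFun U V μ) :
    IndepFun (fun x : Ω × E => (x.2, U x.1)) (fun x => V x.1) (μ.prod π) := by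
  have : IsProbabilityMeasure (μ.map U) := Measure.isProbabilityMeasure_map hU.aemeasurable
  have : IsProbabilityMeasure (μ.map V) := Measure.isProbabilityMeasure_map hV.aemeasurable
  have hfst : Measurable fun x : Ω × E => (x.2, U x.1) :=
    measurable_snd.prodMk (hU.comp measurable_fst)
  have hsnd : Measurable fun x : Ω × E => V x.1 := hV.comp measurable_fst
  have hpair : Measurable fun x : Ω × E => (x.2, (U x.1, V x.1)) :=
    measurable_snd.prodMk ((hU.prodMk hV).comp measurable_fst)
  rw [indepFun_iff_map_prod_eq_prod_map_map hfst.aemeasurable hsnd.aemeasurable,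
    map_prodMk_snd hU, (identDistrib_comp_fst hV.aemeasurable).map_eq,
    ← (measurePreserving_prodAssoc π (μ.map U) (μ.map V)).symm.map_eq,
    ← (indepFun_iff_map_prod_eq_prod_map_map hU.aemeasurable hV.aemeasurable).1 hUV,
    ← map_prodMk_snd (hU.prodMk hV), Measure.map_map (MeasurableEquiv.measurable _) hpair]
  rfl

end Product

section Combine

/-- The aggregated content as a function of the initial content, the netput and the content of the
initially empty network. -/
def combine (p : (Fin n → ℝ) × (Fin n → ℝ) × (Fin n → ℝ)) : Fin n → ℝ :=
  fun j => max (p.1 j + p.2.1 j) (p.2.2 j)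

theorem continuous_combine : Continuous (combine (n := n)) := by
  unfold combine
  fun_prop

theorem measurable_combine : Measurable (combine (n := n)) := continuous_combine.measurable

variable {X : ℝ≥0 → Ω → Fin n → ℝ}

theorem IsLevyProcess.measurable_path (hX : IsLevyProcess X μ) : Measurable fun ω s => X s ω :=
  measurable_pi_lambda _ hX.measurable

theorem IsLevyProcess.indepFun_reflectedPath [IsProbabilityMeasure μ] (hX : IsLevyProcess X μ)
    (h : ℝ≥0) :
    IndepFun (fun ω => (X h ω, reflectedPath (fun s => X s ω) h))
      (fun ω u => X (h + u) ω - X h ω) μ := by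
  have hΦ : Measurable fun p : Set.Iic h → Fin n → ℝ =>
      (p ⟨h, Set.self_mem_Iic⟩, fun j : Fin n =>
        ⨆ q : ℚ≥0, (p ⟨h, Set.self_mem_Iic⟩ j - p ⟨min (q : ℝ≥0) h, Set.mem_Iic.2 (min_le_right _ _)⟩ j)) :=
    Measurable.prodMk (by fun_prop)
      (measurable_pi_lambda _ fun j => Measurable.iSup fun q => by fun_prop)
  exact (hX.indepFun_past_future h).comp hΦ measurable_id

theorem IsLevyProcess.indepFun_runningSup [IsProbabilityMeasure μ] (hX : IsLevyProcess X μ)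
    (h : ℝ≥0) :
    IndepFun (fun ω => (X h ω, runningSup (fun s => X s ω) h))
      (fun ω u => X (h + u) ω - X h ω) μ := by
  have hΦ : Measurable fun p : Set.Iic h → Fin n → ℝ =>
      (p ⟨h, Set.self_mem_Iic⟩, fun j : Fin n =>
        ⨆ q : ℚ≥0, p ⟨min (q : ℝ≥0) h, Set.mem_Iic.2 (min_le_right _ _)⟩ j) :=
    Measurable.prodMk (by fun_prop)
      (measurable_pi_lambda _ fun j => Measurable.iSup fun q => by fun_prop)
  exact (hX.indepFun_past_future h).comp hΦ measurable_id

/-- One-dimensional marginal of the aggregated content with an independent initial content. -/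
theorem IsLevyProcess.identDistrib_aggregateContent [IsProbabilityMeasure μ]
    (hX : IsLevyProcess X μ) {π : Measure (Fin n → ℝ)} [IsProbabilityMeasure π]
    {g : (Fin n → ℝ) → Fin n → ℝ} (hg : Measurable g) (t : ℝ≥0) :
    IdentDistrib (fun x : Ω × (Fin n → ℝ) => aggregateContent (g x.2) (fun s => X s x.1) t)
      (fun x => combine (g x.2, X t x.1, runningSup (fun s => X s x.1) t))
      (μ.prod π) (μ.prod π) := by
  have h1 := hX.identDistrib_reflectedPath t
  have h2 : IdentDistrib
      (fun x : Ω × (Fin n → ℝ) => (X t x.1, reflectedPath (fun s => X s x.1) t))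
      (fun x => (X t x.1, runningSup (fun s => X s x.1) t)) (μ.prod π) (μ.prod π) :=
    (identDistrib_comp_fst h1.aemeasurable_fst).trans
      (h1.trans (identDistrib_comp_fst h1.aemeasurable_snd).symm)
  have hm1 : Measurable fun ω => (X t ω, reflectedPath (fun s => X s ω) t) :=
    (hX.measurable t).prodMk ((measurable_reflectedPath t).comp hX.measurable_path)
  have hm2 : Measurable fun ω => (X t ω, runningSup (fun s => X s ω) t) :=
    (hX.measurable t).prodMk ((measurable_runningSup t).comp hX.measurable_path)
  have h3 := (IdentDistrib.refl (hg.comp measurable_snd).aemeasurable).prodMk h2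
    (indepFun_prod hm1 hg).symm (indepFun_prod hm2 hg).symm
  exact h3.comp measurable_combine

end Combine

/-! ### Invariance and uniqueness of the limit law -/

section Network

variable {J : ℝ≥0 → Ω → Fin n → ℝ} {r : Fin n → ℝ} {P : Matrix (Fin n) (Fin n) ℝ}

/-- An increment over `[s, t]` is a fixed affine function, depending only on `t - s`, of the
increment of `J`. -/
theorem isLevyProcess_freeProcess (hJ : IsLevyProcess J μ) :
    IsLevyProcess (fun t ω => freeProcess r P (fun s => J s ω) t) μ := by
  set g : ℝ → (Fin n → ℝ) → Fin n → ℝ := fun a v => (1 - Pᵀ)⁻¹ *ᵥ (v - a • ((1 - Pᵀ) *ᵥ r)) with hg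
  have hgm : ∀ a, Measurable (g a) := fun a => (by fun_prop : Continuous (g a)).measurable
  have hX : ∀ t ω, freeProcess r P (fun s => J s ω) t = g t (J t ω) := fun t ω => rfl
  have hsub : ∀ (s t : ℝ≥0) (ω : Ω), g t (J t ω) - g s (J s ω) = g ((t : ℝ) - s) (J t ω - J s ω) := by
    intro s t ω
    simp only [hg, ← Matrix.mulVec_sub]
    congr 1
    rw [sub_smul]
    abel
  refine ⟨fun t => ?_, ?_, ?_, ?_, ?_⟩
  · simp only [hX]; exact (hgm t).comp (hJ.measurable t)
  · filter_upwards [hJ.zero] with ω hω using freeProcess_zero hω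
  · filter_upwards [hJ.cadlag] with ω hω using isCadlag_freeProcess hω
  · intro m t ht
    simp only [hX, hsub]
    exact (hJ.indep_increments m t ht).comp (fun i => g ((t i.succ : ℝ) - t i.castSucc))
      fun i => hgm _
  · intro s h
    simp only [hX, hsub]
    rw [show ((s + h : ℝ≥0) : ℝ) - s = h by push_cast; ring]
    exact (hJ.stationary_increments s h).comp (hgm h)

theorem integral_freeProcess_lt_zero [IsProbabilityMeasure μ] (hup : ∀ i j, j ≤ i → P i j = 0)
    (hint : Integrable (J 1) μ) {j : Fin n}
    (hstable : ((1 - Pᵀ)⁻¹ *ᵥ (∫ ω, J 1 ω ∂μ)) j < r j) :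
    Integrable (fun ω => freeProcess r P (fun s => J s ω) 1 j) μ ∧
      ∫ ω, freeProcess r P (fun s => J s ω) 1 j ∂μ < 0 := by
  have hX : ∀ ω, freeProcess r P (fun s => J s ω) 1 j = ((1 - Pᵀ)⁻¹ *ᵥ J 1 ω) j - r j := by
    intro ω
    rw [freeProcess, netput, NNReal.coe_one, one_smul, Matrix.mulVec_sub, inv_mulVec_mulVec hup,
      Pi.sub_apply]
  let A : (Fin n → ℝ) →L[ℝ] ℝ :=
    (ContinuousLinearMap.proj j).comp (Matrix.mulVecLin (1 - Pᵀ)⁻¹).toContinuousLinearMap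
  have hA : ∀ v, ((1 - Pᵀ)⁻¹ *ᵥ v) j = A v := fun v => rfl
  simp only [hX, hA] at hstable ⊢
  have h1 : Integrable (fun ω => A (J 1 ω)) μ := A.integrable_comp hint
  refine ⟨h1.sub (integrable_const _), ?_⟩
  rw [integral_sub h1 (integrable_const _), A.integral_comp_comm hint]
  simpa using hstable

/-- The standing assumptions of the stationarity theorem. -/
structure IsStableTree (J : ℝ≥0 → Ω → Fin n → ℝ) (r : Fin n → ℝ) (P : Matrix (Fin n) (Fin n) ℝ)
    (μ : Measure Ω) : Prop where
  levy : IsLevyProcess J μ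
  routing : IsTreeRouting r P
  path : ∀ᵐ ω ∂μ, IsInputPath fun t => J t ω
  drift : ∀ j, ∀ᵐ ω ∂μ, Tendsto (fun k : ℕ => freeProcess r P (fun s => J s ω) k j) atTop atBot

theorem IsStableTree.ae_bddAbove [IsProbabilityMeasure μ] (h : IsStableTree J r P μ) :
    ∀ᵐ ω ∂μ, ∀ j, BddAbove (Set.range fun t => freeProcess r P (fun s => J s ω) t j) :=
  ae_all_iff.2 fun j => (isLevyProcess_freeProcess h.levy).ae_bddAbove j (h.drift j)

theorem measurable_mulVec (M : Matrix (Fin n) (Fin n) ℝ) :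
    Measurable fun v : Fin n → ℝ => M *ᵥ v :=
  (by fun_prop : Continuous fun v : Fin n → ℝ => M *ᵥ v).measurable

/-- The supremum of the aggregated netput, as a random variable. -/
def netputSup (J : ℝ≥0 → Ω → Fin n → ℝ) (r : Fin n → ℝ) (P : Matrix (Fin n) (Fin n) ℝ) (ω : Ω) :
    Fin n → ℝ :=
  pathSup (freeProcess r P fun s => J s ω)

theorem IsStableTree.measurable_netputSup (h : IsStableTree J r P μ) :
    Measurable (netputSup J r P) :=
  measurable_pathSup.comp (isLevyProcess_freeProcess h.levy).measurable_path

theorem IsStableTree.limitLaw_eq (h : IsStableTree J r P μ) :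
    limitLaw J r P μ = (μ.map (netputSup J r P)).map fun v => (1 - Pᵀ) *ᵥ v := by
  rw [Measure.map_map (measurable_mulVec _) h.measurable_netputSup]
  refine Measure.map_congr ?_
  filter_upwards [h.path] with ω hω
  simp only [Function.comp_apply]
  congr 1
  funext j
  exact (pathSup_apply (isCadlag_freeProcess hω.cadlag) j).symm

theorem IsStableTree.isProbabilityMeasure_limitLaw [IsProbabilityMeasure μ]
    (h : IsStableTree J r P μ) : IsProbabilityMeasure (limitLaw J r P μ) := by
  have := Measure.isProbabilityMeasure_map (μ := μ) h.measurable_netputSup.aemeasurable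
  rw [h.limitLaw_eq]
  exact Measure.isProbabilityMeasure_map (measurable_mulVec _).aemeasurable

theorem IsStableTree.limitLaw_map_inv (h : IsStableTree J r P μ) :
    (limitLaw J r P μ).map (fun w => (1 - Pᵀ)⁻¹ *ᵥ w) = μ.map (netputSup J r P) := by
  rw [h.limitLaw_eq, Measure.map_map (measurable_mulVec _) (measurable_mulVec _)]
  simp only [Function.comp_def, inv_mulVec_mulVec h.routing.routing_upper]
  exact Measure.map_id

theorem IsStableTree.limitLaw_nonneg [IsProbabilityMeasure μ] (h : IsStableTree J r P μ) :
    ∀ᵐ w ∂(limitLaw J r P μ), ∀ j, 0 ≤ w j := by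
  have hmeas : MeasurableSet {w : Fin n → ℝ | ∀ j, 0 ≤ w j} := by
    have : {w : Fin n → ℝ | ∀ j, 0 ≤ w j} = Set.Ici 0 := rfl
    rw [this]; exact measurableSet_Ici
  rw [h.limitLaw_eq, Measure.map_map (measurable_mulVec _) h.measurable_netputSup,
    ae_map_iff ((measurable_mulVec _).comp h.measurable_netputSup).aemeasurable hmeas]
  filter_upwards [h.path, h.ae_bddAbove] with ω hω hb j
  have h1 := h.routing.mulVec_iSup_nonneg hω hb j
  have h2 : supFreeProcess r P (fun s => J s ω) = netputSup J r P ω :=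
    funext fun j => (pathSup_apply (isCadlag_freeProcess hω.cadlag) j).symm
  rwa [h2] at h1

/-- Pathwise uniqueness makes the choice of the version `W` immaterial. -/
theorem IsStableTree.content_ae_eq [IsProbabilityMeasure μ] (h : IsStableTree J r P μ)
    {π : Measure (Fin n → ℝ)} [IsProbabilityMeasure π] {W : ℝ≥0 → Ω × (Fin n → ℝ) → Fin n → ℝ}
    (hW : IsBufferContent J r P μ π W) (t : ℝ≥0) :
    W t =ᵐ[μ.prod π] fun x => (1 - Pᵀ) *ᵥ aggregateContent ((1 - Pᵀ)⁻¹ *ᵥ x.2)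
      (freeProcess r P fun s => J s x.1) t := by
  obtain ⟨L, hL⟩ := hW
  filter_upwards [hL, Measure.quasiMeasurePreserving_fst.ae h.path] with x hx hpath
  exact hx.content_eq_mulVec h.routing hpath t

/-- The buffer content, as an explicit functional of the initial content and of the input. -/
def bufferContent (J : ℝ≥0 → Ω → Fin n → ℝ) (r : Fin n → ℝ) (P : Matrix (Fin n) (Fin n) ℝ)
    (t : ℝ≥0) (x : Ω × (Fin n → ℝ)) : Fin n → ℝ :=
  (1 - Pᵀ) *ᵥ aggregateContent ((1 - Pᵀ)⁻¹ *ᵥ x.2) (freeProcess r P fun s => J s x.1) t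

theorem IsStableTree.isBufferContent [IsProbabilityMeasure μ] (h : IsStableTree J r P μ)
    {π : Measure (Fin n → ℝ)} [IsProbabilityMeasure π] (hπ : ∀ᵐ w ∂π, ∀ j, 0 ≤ w j) :
    IsBufferContent J r P μ π (bufferContent J r P) := by
  refine ⟨fun t x => aggregateContent ((1 - Pᵀ)⁻¹ *ᵥ x.2) (freeProcess r P fun s => J s x.1) t
    - (1 - Pᵀ)⁻¹ *ᵥ x.2 - freeProcess r P (fun s => J s x.1) t, ?_⟩
  filter_upwards [Measure.quasiMeasurePreserving_fst.ae h.path,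
    Measure.quasiMeasurePreserving_snd.ae hπ] with x hpath hx
  exact h.routing.isSkorokhodSolution hpath hx

theorem IsStationaryDistribution.isInvariantDistribution [IsProbabilityMeasure μ]
    {π : Measure (Fin n → ℝ)}
    (hπ : IsStationaryDistribution J r P μ π) : IsInvariantDistribution J r P μ π := by
  have := hπ.isProbabilityMeasure
  obtain ⟨W, hW, hst⟩ := hπ.stationary
  refine ⟨hπ.isProbabilityMeasure, hπ.nonneg, W, hW, fun t => ?_⟩
  have h1 := (hst t).comp (measurable_pi_apply (0 : ℝ≥0))
  simp only [Function.comp_def, zero_add] at h1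
  have h2 : W 0 =ᵐ[μ.prod π] Prod.snd := by
    obtain ⟨L, hL⟩ := hW
    filter_upwards [hL] with x hx using hx.content_zero
  exact ⟨h1.aemeasurable_fst, by
    rw [h1.map_eq, Measure.map_congr h2]; exact measurePreserving_snd.map_eq⟩

/-- The variables `V k` all have the aggregated law of `π`, yet converge almost surely to `X̄`,
whatever the initial content. -/
theorem IsStableTree.eq_limitLaw_of_isInvariant [IsProbabilityMeasure μ]
    (h : IsStableTree J r P μ) {π : Measure (Fin n → ℝ)}
    (hπ : IsInvariantDistribution J r P μ π) : π = limitLaw J r P μ := by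
  have := hπ.isProbabilityMeasure
  have hX : IsLevyProcess (fun t ω => freeProcess r P (fun s => J s ω) t) μ :=
    isLevyProcess_freeProcess h.levy
  obtain ⟨W, hW, hlaw⟩ := hπ.invariant
  set g : (Fin n → ℝ) → Fin n → ℝ := fun w => (1 - Pᵀ)⁻¹ *ᵥ w with hg_def
  have hg : Measurable g := measurable_mulVec _
  set V : ℕ → Ω × (Fin n → ℝ) → Fin n → ℝ := fun k x =>
    combine (g x.2, freeProcess r P (fun s => J s x.1) k,
      runningSup (freeProcess r P fun s => J s x.1) k) with hV
  have hagg : ∀ k : ℕ, IdentDistrib (fun x : Ω × (Fin n → ℝ) => aggregateContent (g x.2)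
      (freeProcess r P fun s => J s x.1) k) (V k) (μ.prod π) (μ.prod π) :=
    fun k => hX.identDistrib_aggregateContent hg k
  have hVlaw : ∀ k, (μ.prod π).map (V k) = π.map g := by
    intro k
    have h1 : ((μ.prod π).map (W k)).map g = π.map g := by rw [(hlaw k).map_eq]
    rw [← (hagg k).map_eq, ← h1, AEMeasurable.map_map_of_aemeasurable
      (by rw [(hlaw k).map_eq]; exact hg.aemeasurable) (hlaw k).aemeasurable]
    refine Measure.map_congr ?_
    filter_upwards [h.content_ae_eq hW k] with x hx
    simp only [Function.comp_apply, hx, hg_def, inv_mulVec_mulVec h.routing.routing_upper]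
  have hVlim : ∀ᵐ x ∂(μ.prod π), Tendsto (fun k => V k x) atTop (𝓝 (netputSup J r P x.1)) := by
    filter_upwards [Measure.quasiMeasurePreserving_fst.ae h.path,
      Measure.quasiMeasurePreserving_fst.ae h.ae_bddAbove,
      Measure.quasiMeasurePreserving_fst.ae (ae_all_iff.2 h.drift)] with x hpath hb hdrift
    have hc := isCadlag_freeProcess (r := r) (P := P) hpath.cadlag
    have h1 := tendsto_pi_nhds.1 (tendsto_runningSup hc hb)
    refine tendsto_pi_nhds.2 fun j => (h1 j).congr' ?_
    -- Eventually `z_j + X_j(k) ≤ 0`, while the running supremum is at least `X_j(0) = 0`: the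
    -- initial content is forgotten.
    filter_upwards [(hdrift j).eventually_le_atBot (-(g x.2 j))] with k hk
    refine (max_eq_right ?_).symm
    have h2 := le_runningSup hc (zero_le : 0 ≤ (k : ℝ≥0)) j
    rw [freeProcess_zero hpath.zero, Pi.zero_apply] at h2
    simp only
    linarith
  have hmap : π.map g = μ.map (netputSup J r P) := by
    have := Measure.isProbabilityMeasure_map (μ := π) hg.aemeasurable
    have := Measure.isProbabilityMeasure_map (μ := μ) h.measurable_netputSup.aemeasurable
    refine ext_of_forall_integral_eq_of_IsFiniteMeasure fun f => ?_
    have hlim : Tendsto (fun k => ∫ x, f (V k x) ∂(μ.prod π)) atTop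
        (𝓝 (∫ x, f (netputSup J r P x.1) ∂(μ.prod π))) := by
      refine tendsto_integral_of_dominated_convergence (fun _ => ‖f‖) (fun k => ?_)
        (integrable_const _) (fun k => Eventually.of_forall fun x => f.norm_coe_le_norm _) ?_
      · exact (f.continuous.measurable.comp_aemeasurable
          (hagg k).aemeasurable_snd).aestronglyMeasurable
      · filter_upwards [hVlim] with x hx using (f.continuous.tendsto _).comp hx
    have hconst : ∀ k, ∫ x, f (V k x) ∂(μ.prod π) = ∫ v, f v ∂(π.map g) := fun k => by
      rw [← hVlaw k, integral_map (hagg k).aemeasurable_snd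
        f.continuous.measurable.aestronglyMeasurable]
    simp only [hconst] at hlim
    have hid := identDistrib_comp_fst (μ := μ) (π := π) h.measurable_netputSup.aemeasurable
    rw [tendsto_nhds_unique tendsto_const_nhds hlim, ← hid.map_eq,
      integral_map hid.aemeasurable_fst f.continuous.measurable.aestronglyMeasurable]
  rw [h.limitLaw_eq, ← hmap, Measure.map_map (measurable_mulVec _) hg]
  simp only [Function.comp_def, hg_def, mulVec_inv_mulVec h.routing.routing_upper]
  exact Measure.map_id.symm

/-- The supremum of the netput satisfies the distributional fixed point equation of the aggregated
content. -/
theorem IsStableTree.identDistrib_netputSup [IsProbabilityMeasure μ] (h : IsStableTree J r P μ)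
    {π : Measure (Fin n → ℝ)} [IsProbabilityMeasure π] (hπ : π = limitLaw J r P μ) (t : ℝ≥0) :
    IdentDistrib (fun x : Ω × (Fin n → ℝ) => aggregateContent ((1 - Pᵀ)⁻¹ *ᵥ x.2)
      (freeProcess r P fun s => J s x.1) t) (fun x => (1 - Pᵀ)⁻¹ *ᵥ x.2)
      (μ.prod π) (μ.prod π) := by
  set X : ℝ≥0 → Ω → Fin n → ℝ := fun t ω => freeProcess r P (fun s => J s ω) t with hX_def
  have hX : IsLevyProcess X μ := isLevyProcess_freeProcess h.levy
  have hg : Measurable fun w : Fin n → ℝ => (1 - Pᵀ)⁻¹ *ᵥ w := measurable_mulVec _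
  have hz : IdentDistrib (fun x : Ω × (Fin n → ℝ) => (1 - Pᵀ)⁻¹ *ᵥ x.2) (netputSup J r P)
      (μ.prod π) μ := by
    refine (identDistrib_comp_snd hg.aemeasurable).trans
      ⟨hg.aemeasurable, h.measurable_netputSup.aemeasurable, ?_⟩
    rw [hπ, h.limitLaw_map_inv]
  have hshift : IdentDistrib (fun ω => pathSup fun u => X (t + u) ω - X t ω) (netputSup J r P)
      μ μ := (hX.identDistrib_shift t).comp measurable_pathSup
  have hm : Measurable fun ω => (X t ω, runningSup (fun s => X s ω) t) :=
    (hX.measurable t).prodMk ((measurable_runningSup t).comp hX.measurable_path)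
  -- The initial content may be replaced by the supremum of the increments after `t`: both are
  -- copies of `X̄` independent of `(X t, runningSup t)`.
  have hpair := (hz.trans hshift.symm).prodMk (identDistrib_comp_fst hm.aemeasurable)
    (indepFun_prod hm hg).symm
    (((hX.indepFun_runningSup t).comp measurable_id measurable_pathSup).symm)
  refine (hX.identDistrib_aggregateContent hg t).trans
    ((hpair.comp measurable_combine).trans (IdentDistrib.trans ?_ hz.symm))
  refine IdentDistrib.of_ae_eq (hpair.comp measurable_combine).aemeasurable_snd ?_
  filter_upwards [h.path, h.ae_bddAbove] with ω hω hb
  exact pathSup_eq_sup (isCadlag_freeProcess hω.cadlag) hb t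

theorem IsStableTree.isStationary_limitLaw [IsProbabilityMeasure μ] (h : IsStableTree J r P μ) :
    IsStationaryDistribution J r P μ (limitLaw J r P μ) := by
  have := h.isProbabilityMeasure_limitLaw
  refine ⟨this, h.limitLaw_nonneg, bufferContent J r P, h.isBufferContent h.limitLaw_nonneg,
    fun t => ?_⟩
  set X : ℝ≥0 → Ω → Fin n → ℝ := fun t ω => freeProcess r P (fun s => J s ω) t with hX_def
  have hX : IsLevyProcess X μ := isLevyProcess_freeProcess h.levy
  have hg : Measurable fun w : Fin n → ℝ => (1 - Pᵀ)⁻¹ *ᵥ w := measurable_mulVec _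
  have hshift := hX.identDistrib_shift t
  have hm : Measurable fun ω => (X t ω, reflectedPath (fun s => X s ω) t) :=
    (hX.measurable t).prodMk ((measurable_reflectedPath t).comp hX.measurable_path)
  have hmfut : Measurable fun ω u => X (t + u) ω - X t ω :=
    measurable_pi_lambda _ fun u => (hX.measurable _).sub (hX.measurable _)
  have hind := (indepFun_prodMk_snd (π := limitLaw J r P μ) hm hmfut
    (hX.indepFun_reflectedPath t)).comp
      (measurable_combine.comp ((hg.comp measurable_fst).prodMk measurable_snd)) measurable_id
  -- The content at `t` and the increments after `t` are jointly distributed like the initial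
  -- content and `X`; the flow property then transfers this to the whole process.
  have hpair := (h.identDistrib_netputSup rfl t).prodMk
    ((identDistrib_comp_fst hshift.aemeasurable_fst).trans
      (hshift.trans (identDistrib_comp_fst hshift.aemeasurable_snd).symm))
    hind (indepFun_prod hX.measurable_path hg).symm
  have hΦ : Measurable fun (p : (Fin n → ℝ) × (ℝ≥0 → Fin n → ℝ)) (s : ℝ≥0) =>
      (1 - Pᵀ) *ᵥ aggregateContent p.1 p.2 s :=
    measurable_pi_lambda _ fun s => (measurable_mulVec _).comp (measurable_aggregateContent s)
  refine IdentDistrib.trans ?_ (hpair.comp hΦ)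
  refine (IdentDistrib.of_ae_eq (hpair.comp hΦ).aemeasurable_fst ?_).symm
  filter_upwards [Measure.quasiMeasurePreserving_fst.ae h.path] with x hx
  funext s
  simp only [Function.comp_apply, bufferContent, hX_def]
  rw [add_comm s t, ← aggregateContent_add (isCadlag_freeProcess hx.cadlag)]

end Network

end Stationarity

end FluidNetwork

end

theorem corollary5p1 {n : ℕ} {Ω : Type*} [MeasurableSpace Ω] (μ : Measure Ω)
    [IsProbabilityMeasure μ] (J : ℝ≥0 → Ω → Fin n → ℝ) (r : Fin n → ℝ)
    (P : Matrix (Fin n) (Fin n) ℝ)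
    (hnet : FluidNetwork.IsTreeFluidNetwork J r P μ)
    (hT1 : ∀ i j, 0 < P i j → r j / r i < P i j)
    (hT2 : ∀ᵐ ω ∂μ, ∀ j : Fin n, 0 < (j : ℕ) → Monotone fun t => J t ω j)
    (hT4_integrable : ∀ t, Integrable (J t) μ)
    (hT4_stable : ∀ j, ((1 - Pᵀ)⁻¹ *ᵥ (∫ ω, J 1 ω ∂μ)) j < r j) :
    (∀ᵐ ω ∂μ, ∀ j, BddAbove
      (Set.range fun t => FluidNetwork.freeProcess r P (fun s => J s ω) t j)) ∧
    (∀ π : Measure (Fin n → ℝ), FluidNetwork.IsStationaryDistribution J r P μ π ↔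
      π = FluidNetwork.limitLaw J r P μ) ∧
    (∀ π : Measure (Fin n → ℝ), FluidNetwork.IsInvariantDistribution J r P μ π ↔
      π = FluidNetwork.limitLaw J r P μ) := by
  have h : FluidNetwork.IsStableTree J r P μ := by
    refine ⟨hnet.levy, ⟨hnet.rate_pos, hnet.routing_nonneg, hnet.routing_upper, hnet.one_feeder,
      hT1⟩, ?_, fun j => ?_⟩
    · filter_upwards [hnet.levy.zero, hnet.levy.cadlag, hT2] with ω h0 hc hm
      exact ⟨hc, h0, hm⟩
    · obtain ⟨hint, hneg⟩ := FluidNetwork.integral_freeProcess_lt_zero hnet.routing_upper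
        (hT4_integrable 1) (hT4_stable j)
      exact (FluidNetwork.isLevyProcess_freeProcess hnet.levy).tendsto_atBot j hint hneg
  have hinv : ∀ {π : Measure (Fin n → ℝ)}, FluidNetwork.IsStationaryDistribution J r P μ π →
      FluidNetwork.IsInvariantDistribution J r P μ π :=
    FluidNetwork.IsStationaryDistribution.isInvariantDistribution
  refine ⟨h.ae_bddAbove, fun π => ⟨fun hπ => h.eq_limitLaw_of_isInvariant (hinv hπ), ?_⟩,
    fun π => ⟨h.eq_limitLaw_of_isInvariant, ?_⟩⟩
  · rintro rfl; exact h.isStationary_limitLaw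
  · rintro rfl; exact hinv h.isStationary_limitLaw
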